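/- Let $a>b>0$ and let $P^6\subset\mathbb R^9$ be the set of all $(\omega,\alpha,\beta)\in\mathbb R^3\times\mathbb R^3\times\mathbb R^3$ with $|\alpha|=a$, $|\beta|=b$, $\alpha\cdot\beta=0$. Let $\gamma=\alpha\times\beta$ and let $J=H\times K\times G:P^6\to\mathbb R^3$, with values written $(h,k,g)$, where $$H=\omega_1^2+\omega_2^2+\tfrac12\omega_3^2-(\alpha_1+\beta_2),\qquad K=(\omega_1^2-\omega_2^2+\alpha_1-\beta_2)^2+(2\omega_1\omega_2+\alpha_2+\beta_1)^2,$$ $$G=(\alpha_1\omega_1+\alpha_2\omega_2+\tfrac12\alpha_3\omega_3)^2+(\beta_1\omega_1+\beta_2\omega_2+\tfrac12\beta_3\omega_3)^2+\omega_3(\gamma_1\omega_1+\gamma_2\omega_2+\tfrac12\gamma_3\omega_3)-\alpha_1b^2-\beta_2a^2$$ are the first integrals of the generalized Kowalevski top in two force fields. Let $\Sigma=J(c(J))$ be the bifurcation diagram of $J$, where $c(J)$ is the set of points of $P^6$ at which the rank of the differential of $J$ is less than $3$. Let $\Sigma_4\subset\mathbb R^3$ be the set of $(h,k,g)$ for which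 the polynomial $$\psi(s)=s^2(s-h)^2+(a^2+b^2-k)s^2-2gs+a^2b^2$$ has a real multiple root. For real $s$, one has $\psi(s)=\psi'(s)=0$ if and only if $s\ne0$ and $$g=s^2(h-s)+\frac{a^2b^2}{s},\qquad k=3s^2-4hs+h^2+a^2+b^2-\frac{a^2b^2}{s^2},\qquad(*)$$ so that the pairs $(s,h)$ with $s\neq 0$ parametrize $\Sigma_4$ (not injectively). Put $\varphi(s)=\sqrt{(s^2-a^2)(s^2-b^2)/s^2}$. The function $2s+\varphi(s)$ maps $[-b,0)$ onto $[-2b,\infty)$, strictly increasing, and maps $(0,b]$ onto $[2b,\infty)$, strictly decreasing; let $s_1$ and $s_2$ be the respective inverse functions. The function $2s-\varphi(s)$ has exactly one critical point $s_0$ in $(a,\infty)$; with $h_0=2s_0-\varphi(s_0)$ one has $a+b<h_0<2a$, and $2s-\varphi(s)$ maps $[a,s_0]$ onto $[h_0,2a]$, strictly decreasing, and $[s_0,\infty)$ onto $[h_0,\infty)$, strictly increasing; let $s_3$ and $s_4$ be the respective inverse functions. Finally let $$s_5(h)=\frac{h-\sqrt{h^2-4ab}}2,\qquad s_6(h)=\frac{h+\sqrt{h^2-4ab}}2,\qquad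 s_7(h)=\frac{h+\sqrt{h^2+4ab}}2 .$$ Then for $s\neq0$ and $h\in\mathbb R$ the point $(h,k,g)$ given by $(*)$ belongs to $\Sigma_4\cap\Sigma$ if and only if one of the following holds. For $s<0$: (i) $-(a+b)\le h\le-2\sqrt{ab}$ and $s\in[-a,s_5(h)]\cup[s_6(h),-b]$; (ii) $-2\sqrt{ab}\le h\le-2b$ and $s\in[-a,-b]$; (iii) $h>-2b$ and $s\in[-a,s_1(h)]$. For $s>0$: (i) $-a+b\le h\le2b$ and $s\in[b,s_7(h)]$; (ii) $2b\le h\le h_0$ and $s\in[s_2(h),s_7(h)]$; (iii) $h_0\le h\le2a$ and $s\in[s_2(h),s_3(h)]\cup[s_4(h),s_7(h)]$; (iv) $h>2a$ and $s\in[s_2(h),a]\cup[s_4(h),s_7(h)]$. Consequently $\Sigma_4\cap\Sigma$ is exactly the image under $(*)$ of the set of $(s,h)$ described by these conditions. -/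

import Mathlib

noncomputable section

namespace KowalevskiTop

/-- Vectors of `ℝ³`, given by their components in the moving frame; the components with indices
`1, 2, 3` of the mathematical text are the values at `0, 1, 2`. -/
abbrev V3 := Fin 3 → ℝ

/-- The ambient space `ℝ⁹` of triples `(ω, α, β)`. -/
abbrev Ambient := V3 × V3 × V3

/-- The energy integral `H`. -/
def H (x : Ambient) : ℝ :=
  let ω := x.1
  let α := x.2.1
  let β := x.2.2
  ω 0 ^ 2 + ω 1 ^ 2 + ω 2 ^ 2 / 2 - (α 0 + β 1)

/-- The generalized Kowalevski integral `K`. -/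
def K (x : Ambient) : ℝ :=
  let ω := x.1
  let α := x.2.1
  let β := x.2.2
  (ω 0 ^ 2 - ω 1 ^ 2 + α 0 - β 1) ^ 2 + (2 * ω 0 * ω 1 + α 1 + β 0) ^ 2

/-- The third integral `G`; here `γ = α × β`. -/
def G (a b : ℝ) (x : Ambient) : ℝ :=
  let ω := x.1
  let α := x.2.1
  let β := x.2.2
  let γ := crossProduct α β
  (α 0 * ω 0 + α 1 * ω 1 + α 2 * ω 2 / 2) ^ 2
    + (β 0 * ω 0 + β 1 * ω 1 + β 2 * ω 2 / 2) ^ 2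
    + ω 2 * (γ 0 * ω 0 + γ 1 * ω 1 + γ 2 * ω 2 / 2)
    - α 0 * b ^ 2 - β 1 * a ^ 2

/-- The integral map `J = H × K × G` with values `(h, k, g)` (as a map on `ℝ⁹`, to be restricted
to the phase space). -/
def J (a b : ℝ) (x : Ambient) : ℝ × ℝ × ℝ := (H x, K x, G a b x)

/-- The geometric integrals `(|α|², |β|², α · β)`. -/
def geom (x : Ambient) : ℝ × ℝ × ℝ :=
  let α := x.2.1
  let β := x.2.2
  (α 0 ^ 2 + α 1 ^ 2 + α 2 ^ 2, β 0 ^ 2 + β 1 ^ 2 + β 2 ^ 2,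
    α 0 * β 0 + α 1 * β 1 + α 2 * β 2)

/-- The phase space `P⁶ = {|α| = a, |β| = b, α ⟂ β} ⊆ ℝ⁹`, a regular level set of `geom`
for `a, b > 0`. -/
def P6 (a b : ℝ) : Set Ambient := {x | geom x = (a ^ 2, b ^ 2, 0)}

/-- The tangent space of `P⁶` at its point `x`: the kernel of the differential of the defining
functions. -/
def tangent (x : Ambient) : Submodule ℝ Ambient := (fderiv ℝ geom x).ker

/-- The rank of the differential at `x` of the restriction of `J` to `P⁶`. -/
def rankJ (a b : ℝ) (x : Ambient) : ℕ :=
  Module.finrank ℝ ((tangent x).map (fderiv ℝ (J a b) x).toLinearMap)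

/-- The set of critical points of `J : P⁶ → ℝ³`. -/
def criticalSet (a b : ℝ) : Set Ambient := {x | x ∈ P6 a b ∧ rankJ a b x < 3}

/-- The bifurcation diagram `Σ` of `J : P⁶ → ℝ³`: the set of its critical values `(h, k, g)`. -/
def bifDiagram (a b : ℝ) : Set (ℝ × ℝ × ℝ) := J a b '' criticalSet a b

/-- The polynomial `ψ(s) = s² (s - h)² + (p² - k) s² - 2 g s + γ²`, where `p² = a² + b²` and
`γ = a b`. -/
def psi (a b h k g : ℝ) : Polynomial ℝ :=
  Polynomial.X ^ 2 * (Polynomial.X - Polynomial.C h) ^ 2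
    + Polynomial.C (a ^ 2 + b ^ 2 - k) * Polynomial.X ^ 2
    - Polynomial.C (2 * g) * Polynomial.X + Polynomial.C ((a * b) ^ 2)

/-- `s` is a multiple root of `ψ`. -/
def IsMultipleRoot (a b h k g s : ℝ) : Prop :=
  (psi a b h k g).IsRoot s ∧ (Polynomial.derivative (psi a b h k g)).IsRoot s

/-- The sheet `Σ₄`: the surface in the space of `(h, k, g)` on which `ψ` has a multiple root. -/
def sheet4 (a b : ℝ) : Set (ℝ × ℝ × ℝ) :=
  {y | ∃ s : ℝ, IsMultipleRoot a b y.1 y.2.1 y.2.2 s}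

/-- The point `(h, k, g)` of `Σ₄` with parameters `(s, h)`, `s ≠ 0`. -/
def sheet4Param (a b s h : ℝ) : ℝ × ℝ × ℝ :=
  (h,
   3 * s ^ 2 - 4 * h * s + h ^ 2 + (a ^ 2 + b ^ 2) - (a * b) ^ 2 / s ^ 2,
   s ^ 2 * (h - s) + (a * b) ^ 2 / s)

/-- `φ(s) = √((s² - a²)(s² - b²) / s²)`. -/
def phi (a b s : ℝ) : ℝ := √((s ^ 2 - a ^ 2) * (s ^ 2 - b ^ 2) / s ^ 2)

/-- The function `h = 2 s + φ(s)` of the curves `δ₁` (`s ∈ [-b, 0)`) and `δ₂` (`s ∈ (0, b]`). -/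
def hPlus (a b s : ℝ) : ℝ := 2 * s + phi a b s

/-- The function `h = 2 s - φ(s)` of the curve `δ₃` (`s ∈ [a, ∞)`). -/
def hMinus (a b s : ℝ) : ℝ := 2 * s - phi a b s

/-- The (unique) critical point in `(a, ∞)` of `h = 2 s - φ(s)`. -/
def s₀ (a b : ℝ) : ℝ := sInf {s | a < s ∧ deriv (hMinus a b) s = 0}

/-- The value of `h = 2 s - φ(s)` at its critical point, the minimal one on `δ₃`. -/
def h₀ (a b : ℝ) : ℝ := hMinus a b (s₀ a b)

/-- The inverse of `h = 2 s + φ(s)`, `s ∈ [-b, 0)`. -/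
def s₁ (a b : ℝ) : ℝ → ℝ := Function.invFunOn (hPlus a b) (Set.Ico (-b) 0)

/-- The inverse of `h = 2 s + φ(s)`, `s ∈ (0, b]`. -/
def s₂ (a b : ℝ) : ℝ → ℝ := Function.invFunOn (hPlus a b) (Set.Ioc 0 b)

/-- The inverse of `h = 2 s - φ(s)`, `s ∈ [a, s₀]`. -/
def s₃ (a b : ℝ) : ℝ → ℝ := Function.invFunOn (hMinus a b) (Set.Icc a (s₀ a b))

/-- The inverse of `h = 2 s - φ(s)`, `s ∈ [s₀, ∞)`. -/
def s₄ (a b : ℝ) : ℝ → ℝ := Function.invFunOn (hMinus a b) (Set.Ici (s₀ a b))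

/-- The smaller root of `s + a b / s = h`. -/
def s₅ (a b h : ℝ) : ℝ := (h - √(h ^ 2 - 4 * (a * b))) / 2

/-- The larger root of `s + a b / s = h`. -/
def s₆ (a b h : ℝ) : ℝ := (h + √(h ^ 2 - 4 * (a * b))) / 2

/-- The positive root of `s - a b / s = h`. -/
def s₇ (a b h : ℝ) : ℝ := (h + √(h ^ 2 + 4 * (a * b))) / 2

/-- The systems of inequalities for negative `s`. -/
def NegRegion (a b s h : ℝ) : Prop :=
  (-(a + b) ≤ h ∧ h ≤ -2 * √(a * b) ∧
      s ∈ Set.Icc (-a) (s₅ a b h) ∪ Set.Icc (s₆ a b h) (-b)) ∨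
  (-2 * √(a * b) ≤ h ∧ h ≤ -2 * b ∧ s ∈ Set.Icc (-a) (-b)) ∨
  (-2 * b < h ∧ s ∈ Set.Icc (-a) (s₁ a b h))

/-- The systems of inequalities for positive `s`. -/
def PosRegion (a b s h : ℝ) : Prop :=
  (-a + b ≤ h ∧ h ≤ 2 * b ∧ s ∈ Set.Icc b (s₇ a b h)) ∨
  (2 * b ≤ h ∧ h ≤ h₀ a b ∧ s ∈ Set.Icc (s₂ a b h) (s₇ a b h)) ∨
  (h₀ a b ≤ h ∧ h ≤ 2 * a ∧
      s ∈ Set.Icc (s₂ a b h) (s₃ a b h) ∪ Set.Icc (s₄ a b h) (s₇ a b h)) ∨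
  (2 * a < h ∧ s ∈ Set.Icc (s₂ a b h) a ∪ Set.Icc (s₄ a b h) (s₇ a b h))

end KowalevskiTop

end

open KowalevskiTop

/-!
The point of the sheet `Σ₄` with parameters `(s, h)` is a critical value if and only if the pair is
`Admissible`: a list of four systems of inequalities, one for each position of `s` with respect to
`-b`, `b`, `a`, written directly in terms of `s + a b / s`, `s - a b / s` and `2 s ± φ(s)`. The
inequalities solved for `s` are then the regions of the theorem.

*Critical values are admissible.* The rank of `J` drops where a combination
`c₁ dH + c₂ dK + c₃ dG` vanishes on the tangent space (`rankJ_lt_three_iff`), that is, along `ω` and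
along the rotations of the frame `(α, β)`. In the complex variables `w = ω₁ + iω₂`,
`x = α₁ - β₂ + i(α₂ + β₁)`, `y = α₁ + β₂ + i(α₂ - β₁)`, `z = α₃ + iβ₃` these equations can be solved
far enough to see that a critical point has `K = 0`, or lies over one of the sheets
`2 g = p² h ± r² √k`, or over `Σ₄`, or is a pendulum motion (`critical_classification`). For a point
of `Σ₄` the identity `s² ((h - 2 s)² - k) = (s² - a²)(s² - b²)` gives `|h - 2 s| ≥ φ(s)`. Over `Σ₄`
the sign of `h - 2 s` comes from a sum of squares and the bounds `s ± a b / s` from `|γ₃| ≤ a b`;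
for the other three types the value lies on the intersection of `Σ₄` with another surface, where
`h` is determined by `s` or `s` is `±a`, `±b`, and `h ≥ -(a + b)` excludes the rest
(`admissible_of_critical`).

*Admissible parameters are attained.* Already the points with `β = (0, ±b, 0)` and `ω₂ = 0` suffice
off `s = ±a`, `s = ±b`: the equations of `IsSheetFourPoint` then reduce to a quadratic equation with
discriminant `4 s⁴ k` for a positive number proportional to `ω₃²`, and `|α₁| ≤ a` becomes
a bound for its root. Such points are critical with the multiplier `(s (s - h), s / 2, 1)`
(`Admissible.mem_bifDiagram`).

*The functions `2 s ± φ(s)`.* Their derivatives change sign where `(s - a² b² / s³)² = 4 φ(s)²`, a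
quartic equation in `s²`; the quartic (`slopeQuartic`) is positive on `(0, b²]`, positive at `a²` and
strictly decreasing on `[a², ∞)`. -/

namespace KowalevskiTop

noncomputable section

open ComplexConjugate

/-! ### Differentials and Lagrange multipliers -/

/-- The differential of `H` at `x` in the direction `v`. -/
def dH (x v : Ambient) : ℝ :=
  2 * x.1 0 * v.1 0 + 2 * x.1 1 * v.1 1 + x.1 2 * v.1 2 - (v.2.1 0 + v.2.2 1)

/-- The differential of `K` at `x` in the direction `v`. -/
def dK (x v : Ambient) : ℝ :=
  2 * (x.1 0 ^ 2 - x.1 1 ^ 2 + x.2.1 0 - x.2.2 1)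
      * (2 * x.1 0 * v.1 0 - 2 * x.1 1 * v.1 1 + v.2.1 0 - v.2.2 1)
    + 2 * (2 * x.1 0 * x.1 1 + x.2.1 1 + x.2.2 0)
      * (2 * x.1 0 * v.1 1 + 2 * x.1 1 * v.1 0 + v.2.1 1 + v.2.2 0)

/-- The differential of `G` at `x` in the direction `v`. -/
def dG (a b : ℝ) (x v : Ambient) : ℝ :=
  let ω := x.1
  let α := x.2.1
  let β := x.2.2
  let o := v.1
  let p := v.2.1
  let q := v.2.2
  2 * (α 0 * ω 0 + α 1 * ω 1 + α 2 * ω 2 / 2)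
      * (α 0 * o 0 + α 1 * o 1 + α 2 * o 2 / 2 + (p 0 * ω 0 + p 1 * ω 1 + p 2 * ω 2 / 2))
    + 2 * (β 0 * ω 0 + β 1 * ω 1 + β 2 * ω 2 / 2)
      * (β 0 * o 0 + β 1 * o 1 + β 2 * o 2 / 2 + (q 0 * ω 0 + q 1 * ω 1 + q 2 * ω 2 / 2))
    + o 2 * ((α 1 * β 2 - α 2 * β 1) * ω 0 + (α 2 * β 0 - α 0 * β 2) * ω 1
        + (α 0 * β 1 - α 1 * β 0) * ω 2 / 2)
    + ω 2 * ((α 1 * β 2 - α 2 * β 1) * o 0 + (α 2 * β 0 - α 0 * β 2) * o 1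
        + (α 0 * β 1 - α 1 * β 0) * o 2 / 2)
    + ω 2 * ((p 1 * β 2 + α 1 * q 2 - p 2 * β 1 - α 2 * q 1) * ω 0
        + (p 2 * β 0 + α 2 * q 0 - p 0 * β 2 - α 0 * q 2) * ω 1
        + (p 0 * β 1 + α 0 * q 1 - p 1 * β 0 - α 1 * q 0) * ω 2 / 2)
    - p 0 * b ^ 2 - q 1 * a ^ 2

theorem G_eq (a b : ℝ) (x : Ambient) : G a b x =
    (x.2.1 0 * x.1 0 + x.2.1 1 * x.1 1 + x.2.1 2 * x.1 2 / 2) ^ 2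
    + (x.2.2 0 * x.1 0 + x.2.2 1 * x.1 1 + x.2.2 2 * x.1 2 / 2) ^ 2
    + x.1 2 * ((x.2.1 1 * x.2.2 2 - x.2.1 2 * x.2.2 1) * x.1 0
        + (x.2.1 2 * x.2.2 0 - x.2.1 0 * x.2.2 2) * x.1 1
        + (x.2.1 0 * x.2.2 1 - x.2.1 1 * x.2.2 0) * x.1 2 / 2)
    - x.2.1 0 * b ^ 2 - x.2.2 1 * a ^ 2 := by
  simp [G, cross_apply]

theorem differentiable_J (a b : ℝ) : Differentiable ℝ (J a b) := by
  have : J a b = fun x => (H x, K x, G a b x) := rfl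
  rw [this]
  simp only [H, K, G_eq]
  fun_prop

theorem differentiable_geom : Differentiable ℝ geom := by
  have : geom = fun x => geom x := rfl
  rw [this]
  simp only [geom]
  fun_prop

theorem hasDerivAt_affine (c d : ℝ) : HasDerivAt (fun t : ℝ => c + t * d) d 0 := by
  simpa using ((hasDerivAt_id (0 : ℝ)).mul_const d).const_add c

theorem fderiv_apply_of_line {E F : Type*} [NormedAddCommGroup E] [NormedSpace ℝ E]
    [NormedAddCommGroup F] [NormedSpace ℝ F] {f : E → F} (hf : Differentiable ℝ f) {x v : E}
    {f' : F} (h : HasDerivAt (fun t : ℝ => f (x + t • v)) f' 0) : fderiv ℝ f x v = f' := by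
  rw [← (hf x).lineDeriv_eq_fderiv]
  exact h.deriv

theorem fderiv_J (a b : ℝ) (x v : Ambient) :
    fderiv ℝ (J a b) x v = (dH x v, dK x v, dG a b x v) := by
  refine fderiv_apply_of_line (differentiable_J a b) ?_
  obtain ⟨ω, α, β⟩ := x
  obtain ⟨o, p, q⟩ := v
  have hω := fun i => hasDerivAt_affine (ω i) (o i)
  have hα := fun i => hasDerivAt_affine (α i) (p i)
  have hβ := fun i => hasDerivAt_affine (β i) (q i)
  have h1 := ((((hω 0).pow 2).add ((hω 1).pow 2)).add (((hω 2).pow 2).div_const 2)).sub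
    ((hα 0).add (hβ 1))
  have h2 := ((((((hω 0).pow 2).sub ((hω 1).pow 2)).add (hα 0)).sub (hβ 1)).pow 2).add
    ((((((hω 0).const_mul 2).mul (hω 1)).add (hα 1)).add (hβ 0)).pow 2)
  have h3 := ((((((((hα 0).mul (hω 0)).add ((hα 1).mul (hω 1))).add
      (((hα 2).mul (hω 2)).div_const 2)).pow 2).add
    (((((hβ 0).mul (hω 0)).add ((hβ 1).mul (hω 1))).add
      (((hβ 2).mul (hω 2)).div_const 2)).pow 2)).add
    ((hω 2).mul ((((((hα 1).mul (hβ 2)).sub ((hα 2).mul (hβ 1))).mul (hω 0)).add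
      ((((hα 2).mul (hβ 0)).sub ((hα 0).mul (hβ 2))).mul (hω 1))).add
      (((((hα 0).mul (hβ 1)).sub ((hα 1).mul (hβ 0))).mul (hω 2)).div_const 2)))).sub
    ((hα 0).mul_const (b ^ 2))).sub ((hβ 1).mul_const (a ^ 2))
  refine HasDerivAt.prodMk ?_ (HasDerivAt.prodMk ?_ ?_)
  · refine HasDerivAt.congr_deriv h1 ?_
    simp only [dH, Nat.cast_ofNat]
    ring
  · refine HasDerivAt.congr_deriv h2 ?_
    simp only [dK, Pi.add_apply, Pi.sub_apply, Pi.mul_apply, Pi.pow_apply, Nat.cast_ofNat]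
    ring
  · simp only [G_eq]
    refine HasDerivAt.congr_deriv h3 ?_
    simp only [dG, Pi.add_apply, Pi.sub_apply, Pi.mul_apply, Nat.cast_ofNat]
    ring

theorem mem_tangent {x v : Ambient} : v ∈ tangent x ↔
    x.2.1 0 * v.2.1 0 + x.2.1 1 * v.2.1 1 + x.2.1 2 * v.2.1 2 = 0 ∧
    x.2.2 0 * v.2.2 0 + x.2.2 1 * v.2.2 1 + x.2.2 2 * v.2.2 2 = 0 ∧
    x.2.1 0 * v.2.2 0 + x.2.1 1 * v.2.2 1 + x.2.1 2 * v.2.2 2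
      + (v.2.1 0 * x.2.2 0 + v.2.1 1 * x.2.2 1 + v.2.1 2 * x.2.2 2) = 0 := by
  have key : fderiv ℝ geom x v =
      (2 * (x.2.1 0 * v.2.1 0 + x.2.1 1 * v.2.1 1 + x.2.1 2 * v.2.1 2),
       2 * (x.2.2 0 * v.2.2 0 + x.2.2 1 * v.2.2 1 + x.2.2 2 * v.2.2 2),
       x.2.1 0 * v.2.2 0 + x.2.1 1 * v.2.2 1 + x.2.1 2 * v.2.2 2
        + (v.2.1 0 * x.2.2 0 + v.2.1 1 * x.2.2 1 + v.2.1 2 * x.2.2 2)) := by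
    refine fderiv_apply_of_line differentiable_geom ?_
    obtain ⟨ω, α, β⟩ := x
    obtain ⟨o, p, q⟩ := v
    have hα := fun i => hasDerivAt_affine (α i) (p i)
    have hβ := fun i => hasDerivAt_affine (β i) (q i)
    refine HasDerivAt.prodMk ?_ (HasDerivAt.prodMk ?_ ?_)
    · refine HasDerivAt.congr_deriv ((((hα 0).pow 2).add ((hα 1).pow 2)).add ((hα 2).pow 2)) ?_
      simp only [Nat.cast_ofNat]
      ring
    · refine HasDerivAt.congr_deriv ((((hβ 0).pow 2).add ((hβ 1).pow 2)).add ((hβ 2).pow 2)) ?_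
      simp only [Nat.cast_ofNat]
      ring
    · have h := (((hα 0).mul (hβ 0)).add ((hα 1).mul (hβ 1))).add ((hα 2).mul (hβ 2))
      refine h.congr_deriv ?_
      ring
  rw [tangent, LinearMap.mem_ker]
  change fderiv ℝ geom x v = 0 ↔ _
  rw [key]
  simp [Prod.ext_iff]

/-- The rank of `J` at `x` drops exactly when a nontrivial linear combination of the differentials
of the three integrals vanishes on the tangent space. -/
theorem rankJ_lt_three_iff (a b : ℝ) (x : Ambient) : rankJ a b x < 3 ↔
    ∃ c₁ c₂ c₃ : ℝ, (c₁, c₂, c₃) ≠ 0 ∧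
      ∀ v ∈ tangent x, c₁ * dH x v + c₂ * dK x v + c₃ * dG a b x v = 0 := by
  have h3 : Module.finrank ℝ (ℝ × ℝ × ℝ) = 3 := by simp
  rw [rankJ]
  constructor
  · intro h
    have hlt : (tangent x).map (fderiv ℝ (J a b) x).toLinearMap < ⊤ := by
      rw [lt_top_iff_ne_top]
      intro htop
      rw [htop, finrank_top, h3] at h
      exact lt_irrefl _ h
    obtain ⟨f, hf, hle⟩ := Submodule.exists_le_ker_of_lt_top _ hlt
    have hfe : ∀ y : ℝ × ℝ × ℝ,
        f y = f (1, 0, 0) * y.1 + f (0, 1, 0) * y.2.1 + f (0, 0, 1) * y.2.2 := by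
      intro y
      have : y = y.1 • ((1, 0, 0) : ℝ × ℝ × ℝ) + y.2.1 • ((0, 1, 0) : ℝ × ℝ × ℝ)
          + y.2.2 • ((0, 0, 1) : ℝ × ℝ × ℝ) := by
        ext <;> simp
      conv_lhs => rw [this]
      simp only [map_add, map_smul, smul_eq_mul]
      ring
    refine ⟨f (1, 0, 0), f (0, 1, 0), f (0, 0, 1), ?_, ?_⟩
    · intro h0
      simp only [Prod.mk_eq_zero] at h0
      apply hf
      exact LinearMap.ext fun y => by rw [hfe, h0.1, h0.2.1, h0.2.2]; simp
    · intro v hv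
      have := hle (Submodule.mem_map_of_mem (f := (fderiv ℝ (J a b) x).toLinearMap) hv)
      rw [LinearMap.mem_ker, hfe] at this
      simpa [fderiv_J] using this
  · rintro ⟨c₁, c₂, c₃, hc, hv⟩
    refine lt_of_lt_of_eq (Submodule.finrank_lt ?_) h3
    intro htop
    apply hc
    have hall : ∀ y : ℝ × ℝ × ℝ, c₁ * y.1 + c₂ * y.2.1 + c₃ * y.2.2 = 0 := by
      intro y
      have hy : y ∈ (tangent x).map (fderiv ℝ (J a b) x).toLinearMap := htop ▸ Submodule.mem_top
      obtain ⟨v, hvt, rfl⟩ := hy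
      simpa [fderiv_J] using hv v hvt
    have e1 := hall (1, 0, 0)
    have e2 := hall (0, 1, 0)
    have e3 := hall (0, 0, 1)
    simp at e1 e2 e3
    simp [e1, e2, e3]

/-! ### The critical point equations in complex variables -/

/-- The values of the integrals at a critical point on which `2 G - p² H = r² κ` with `κ² = K`
(`p² = a² + b²`, `r² = a² - b²`), in the complex variables
`w = ω₁ + iω₂`, `x = α₁ - β₂ + i(α₂ + β₁)`, `y = α₁ + β₂ + i(α₂ - β₁)`, `z = α₃ + iβ₃` and
`v = ω₃`. The inequality for `κ` bounds the energy from below. -/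
def SquareRootType (w x y z : ℂ) (v r2 : ℝ) : Prop :=
  ∃ κ : ℝ, (w ^ 2 + x) * conj (w ^ 2 + x) = (κ : ℂ) ^ 2 ∧
    -(z * conj z * (w * conj w)) + (conj x * conj y * w ^ 2 + x * y * conj w ^ 2) / 2
      - x * conj x * v ^ 2 / 2 + v * (x * conj z * conj w + conj x * z * w)
      + r2 / 2 * (x + conj x) = r2 * κ ∧
    |κ - x.re| ≤ ‖w‖ ^ 2

/-- For `x = 0` the value `κ = -|w|²` always works. -/
theorem squareRootType_of_x_eq_zero {w x y z : ℂ} {v r2 : ℝ} (hr : 0 < r2)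
    (hz : z ^ 2 + x * conj y = r2) (hx : x = 0) : SquareRootType w x y z v r2 := by
  subst hx
  have hw : w * conj w = ((‖w‖ ^ 2 : ℝ) : ℂ) := by
    rw [Complex.mul_conj, Complex.normSq_eq_norm_sq]
  have hzz : z * conj z = (r2 : ℂ) := by
    have h1 : z ^ 2 = (r2 : ℂ) := by simpa using hz
    have h2 : ‖z‖ ^ 2 = r2 := by
      rw [← norm_pow, h1, Complex.norm_real, Real.norm_of_nonneg hr.le]
    rw [Complex.mul_conj, Complex.normSq_eq_norm_sq, h2]
  refine ⟨-‖w‖ ^ 2, ?_, ?_, ?_⟩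
  · simp only [add_zero, map_pow]
    push_cast at hw ⊢
    linear_combination (w * conj w + (‖w‖ : ℂ) ^ 2) * hw
  · simp only [map_zero]
    push_cast at hw ⊢
    linear_combination (-(w * conj w)) * hzz - (r2 : ℂ) * hw
  · simp

/-- Off `x = 0` the combination `2 G - p² H` equals `r² Re (W x̄ / x) - F² / (2 |x|²)`, where
`W = w² + x` and `F = |x|² v - 2 Re (x̄ z w)`. -/
theorem squareRootType_of_real_ratio {w x y z : ℂ} {v r2 κ : ℝ}
    (hz : z ^ 2 + x * conj y = r2) (hx : x ≠ 0)
    (hF : x * conj x * v - conj x * z * w - x * conj z * conj w = 0)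
    (hκ : (w ^ 2 + x) * conj x = κ * x) : SquareRootType w x y z v r2 := by
  have hx' : conj x ≠ 0 := by simpa using hx
  have hz' : conj z ^ 2 + conj x * y = r2 := by simpa using congrArg conj hz
  have hκ' : (conj w ^ 2 + conj x) * x = κ * conj x := by simpa using congrArg conj hκ
  refine ⟨κ, ?_, ?_, ?_⟩
  · simp only [map_add, map_pow]
    apply mul_left_cancel₀ (mul_ne_zero hx hx')
    linear_combination ((conj w ^ 2 + conj x) * x) * hκ + (κ * x) * hκ'
  · apply mul_left_cancel₀ (mul_ne_zero hx hx')
    linear_combination (w ^ 2 * conj x ^ 2 / 2) * hz + (conj w ^ 2 * x ^ 2 / 2) * hz'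
      + (r2 * conj x / 2) * hκ + (r2 * x / 2) * hκ'
      - ((x * conj x * v - conj x * z * w - x * conj z * conj w) / 2) * hF
  · have h1 : w ^ 2 * conj x = x * (κ - conj x) := by linear_combination hκ
    have h2 : ‖w‖ ^ 2 * ‖x‖ = ‖x‖ * ‖(κ : ℂ) - conj x‖ := by
      have := congrArg norm h1
      simpa using this
    have h3 : ‖w‖ ^ 2 = ‖(κ : ℂ) - conj x‖ := by
      have hxn : ‖x‖ ≠ 0 := by simpa using hx
      apply mul_left_cancel₀ hxn
      linarith
    rw [h3]
    have := Complex.abs_re_le_norm ((κ : ℂ) - conj x)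
    simpa using this

theorem squareRootType_of_real {w x y z : ℂ} {v r2 : ℝ}
    (hz : z ^ 2 + x * conj y = r2) (hx : x ≠ 0)
    (hF : x * conj x * v - conj x * z * w - x * conj z * conj w = 0)
    (hxr : x = conj x) (hw : w ^ 2 = conj w ^ 2) : SquareRootType w x y z v r2 := by
  have hW : conj (w ^ 2 + x) = w ^ 2 + x := by
    simp only [map_add, map_pow]
    rw [← hw, ← hxr]
  obtain ⟨κ, hκ⟩ := Complex.conj_eq_iff_real.1 hW
  refine squareRootType_of_real_ratio hz hx hF (κ := κ) ?_
  rw [hκ, ← hxr]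

/-- Critical points with a multiplier `(λ, s / 2, 1)`, where `μ = λ + p² / 2`: the
equations `ha`, `hb` say that `μ H + (s / 2) K + (G - p² H / 2)` has no differential along
`(ω₁, ω₂)` and along `ω₃`, the equations `hc`, `hd` that it has none along the rotations of the
frame. Together they give `x̄ P = η z̄`. If `η = 0` then `T = P = 0`, the equations of the sheet
`Σ₄`; if `η ≠ 0` then `F = 0`, and what is left makes the ratio `W x̄ / x` real. -/
theorem classification_of_G_multiplier {w x y z : ℂ} {v s μ r2 : ℝ} (hr : 0 < r2)
    (hz : z ^ 2 + x * conj y = r2)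
    {T T' P η : ℂ}
    (hT : T = (conj y + 2 * s) * w + x * conj w + z * v)
    (hT' : T' = (y + 2 * s) * conj w + conj x * w + conj z * v)
    (hP : P = 2 * s * v * w - x * conj z + (y + 2 * s) * z)
    (hη : η = 2 * μ - z * conj z - x * conj x + 2 * s * (w * conj w))
    (hK : w ^ 2 + x ≠ 0)
    (ha : η * w + x * T' = 0)
    (hb : 2 * μ * v = x * conj x * v - conj x * z * w - x * conj z * conj w)
    (hc : conj w * (conj z * T + z * T') - conj x * v * T - η * conj z + conj x * P = 0)
    (hd : 2 * (s * w + x * conj w) * T' - conj z * P - η * (y + 2 * s)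
      = conj (2 * (s * w + x * conj w) * T' - conj z * P - η * (y + 2 * s))) :
    (T = 0 ∧ P = 0 ∧ 2 * s * (v : ℂ) ^ 2 = (y + 2 * s) * (conj y + 2 * s) - x * conj x) ∨
    (w = 0 ∧ z = 0) ∨ SquareRootType w x y z v r2 := by
  by_cases hx : x = 0
  · exact Or.inr (Or.inr (squareRootType_of_x_eq_zero hr hz hx))
  have hx' : conj x ≠ 0 := by simpa using hx
  have hrc : (r2 : ℂ) ≠ 0 := by exact_mod_cast hr.ne'
  have htwo : conj (2 : ℂ) = 2 := map_ofNat _ 2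
  have hz' : conj z ^ 2 + conj x * y = r2 := by simpa using congrArg conj hz
  have cT : conj T = T' := by rw [hT, hT']; simp [htwo]
  have cT' : conj T' = T := by rw [← cT]; simp
  have cη : conj η = η := by
    rw [hη]; simp only [map_add, map_sub, map_mul, Complex.conj_ofReal, Complex.conj_conj,
      map_ofNat]; ring
  set P' := conj P with hP'0
  have hP' : P' = 2 * s * v * conj w - conj x * z + (conj y + 2 * s) * conj z := by
    rw [hP'0, hP]; simp [htwo]
  have ha' : η * conj w + conj x * T = 0 := by
    have := congrArg conj ha
    simpa [cT', cη] using this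
  have hK' : conj w ^ 2 + conj x ≠ 0 := by
    intro h
    apply hK
    have := congrArg conj h
    simpa using this
  have hb1 : η * v + z * T' - conj w * P = 0 := by
    rw [hη, hT', hP]; linear_combination hb
  have hf : conj x * P = η * conj z := by
    have h0 : (conj w ^ 2 + conj x) * (conj x * P - η * conj z) = 0 := by
      linear_combination conj x * (hc - conj w * hb1 + v * ha') - conj w * conj z * ha'
    have := (mul_eq_zero.1 h0).resolve_left hK'
    linear_combination this
  have hf' : x * P' = η * z := by
    have := congrArg conj hf
    simpa [cη] using this
  by_cases h0 : η = 0
  · have hT0 : T = 0 := by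
      rw [h0] at ha'
      simpa [hx] using ha'
    have hT0' : T' = 0 := by rw [← cT, hT0, map_zero]
    have hP0 : P = 0 := by
      rw [h0] at hf
      simpa [hx] using hf
    have hP0' : P' = 0 := by rw [hP'0, hP0, map_zero]
    by_cases hz0 : z = 0
    · by_cases hw0 : w = 0
      · exact Or.inr (Or.inl ⟨hw0, hz0⟩)
      · left
        have hw0' : conj w ≠ 0 := by simpa using hw0
        refine ⟨hT0, hP0, ?_⟩
        have hsv : 2 * s * (v : ℂ) = 0 := by
          have : 2 * s * (v : ℂ) * w = 0 := by
            rw [← hP0, hP, hz0]; simp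
          exact (mul_eq_zero.1 this).resolve_right hw0
        rw [hT, hz0] at hT0
        rw [hT', hz0] at hT0'
        simp only [map_zero, zero_mul, add_zero] at hT0 hT0'
        apply mul_left_cancel₀ (mul_ne_zero hw0 hw0')
        linear_combination (w * conj w * v) * hsv - (y + 2 * s) * conj w * hT0
          + x * conj w * hT0'
    · left
      refine ⟨hT0, hP0, ?_⟩
      apply mul_left_cancel₀ hz0
      have hs : (conj y + 2 * s) * P + x * P'
          + z * (2 * s * (v : ℂ) ^ 2 - (y + 2 * s) * (conj y + 2 * s) + x * conj x)
          = 2 * s * v * T := by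
        rw [hP, hP', hT]; ring
      linear_combination hs - (conj y + 2 * s) * hP0 - x * hP0' + 2 * s * v * hT0
  · right; right
    have hF : x * conj x * v - conj x * z * w - x * conj z * conj w = 0 := by
      apply mul_left_cancel₀ h0
      linear_combination x * conj x * hb1 - conj x * z * ha + x * conj w * hf
    have hμv : (μ : ℂ) * v = 0 := by linear_combination hb / 2 + hF / 2
    have hE : 2 * μ * w * conj x + conj w * (2 * s * (w ^ 2 + x) * conj x + r2 * x) = 0 := by
      rw [hη, hT'] at ha
      linear_combination conj x * ha - conj z * hF - x * conj w * hz'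
    have hd' : 2 * s * (w ^ 2 * conj x - conj w ^ 2 * x) + r2 * (x - conj x) = 0 := by
      simp only [map_sub, map_mul, map_add, Complex.conj_ofReal, Complex.conj_conj, map_ofNat, cT',
        cη] at hd
      rw [← hP'0] at hd
      apply mul_left_cancel₀ h0
      linear_combination (-(x * conj x)) * hd + 2 * conj x * (s * w + x * conj w) * ha
        - 2 * x * (s * conj w + conj x * w) * ha' - x * conj z * hf + conj x * z * hf'
        - η * x * hz' + η * conj x * hz
    by_cases hw0 : w = 0
    · have hxr : x = conj x := by
        rw [hw0] at hd'
        apply mul_left_cancel₀ hrc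
        simp only [map_zero] at hd'
        linear_combination hd'
      exact squareRootType_of_real hz hx hF hxr (by simp [hw0])
    have hw0' : conj w ≠ 0 := by simpa using hw0
    by_cases hμ : μ = 0
    · have h2 : 2 * s * (w ^ 2 + x) * conj x + r2 * x = 0 := by
        rw [hμ] at hE
        simpa [hw0] using hE
      have hs : s ≠ 0 := by
        intro hs
        rw [hs] at h2
        simp [hx, hr.ne'] at h2
      have hsc : (s : ℂ) ≠ 0 := by exact_mod_cast hs
      refine squareRootType_of_real_ratio hz hx hF (κ := -r2 / (2 * s)) ?_
      push_cast
      field_simp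
      linear_combination h2
    · have hμc : (μ : ℂ) ≠ 0 := by exact_mod_cast hμ
      have hE' : 2 * μ * conj w * x
          + w * (2 * s * (conj w ^ 2 + conj x) * x + r2 * conj x) = 0 := by
        simpa [htwo] using congrArg conj hE
      have hwx : w ^ 2 * conj x = conj w ^ 2 * x := by
        apply mul_left_cancel₀ hμc
        linear_combination w * hE / 2 - conj w * hE' / 2 - w * conj w / 2 * hd'
      have hxr : x = conj x := by
        apply mul_left_cancel₀ hrc
        linear_combination hd' - 2 * s * hwx
      refine squareRootType_of_real hz hx hF hxr ?_
      apply mul_right_cancel₀ hx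
      linear_combination hwx + w ^ 2 * hxr

/-- Critical points with a multiplier `(c₁, c₂, 0)`, at which the differentials of `H` and `K`
are dependent. -/
theorem classification_of_H_K_multiplier {w x y z : ℂ} {v c₁ c₂ r2 : ℝ} (hr : 0 < r2)
    (hz : z ^ 2 + x * conj y = r2) (hc : c₁ ≠ 0 ∨ c₂ ≠ 0)
    (hK : w ^ 2 + x ≠ 0) (hv : c₁ * v = 0)
    (ha : c₁ * conj w + 2 * c₂ * (conj w ^ 2 + conj x) * w = 0)
    (hb : c₁ * conj z = 2 * c₂ * (conj w ^ 2 + conj x) * z)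
    (hd : c₁ * (y - conj y) = 2 * c₂ * (x * conj w ^ 2 - conj x * w ^ 2)) :
    (w = 0 ∧ z = 0) ∨ SquareRootType w x y z v r2 := by
  by_cases hx : x = 0
  · exact Or.inr (squareRootType_of_x_eq_zero hr hz hx)
  have hrc : (r2 : ℂ) ≠ 0 := by exact_mod_cast hr.ne'
  have htwo : conj (2 : ℂ) = 2 := map_ofNat _ 2
  have hz' : conj z ^ 2 + conj x * y = r2 := by simpa using congrArg conj hz
  have hK' : conj w ^ 2 + conj x ≠ 0 := by
    intro h
    apply hK
    have := congrArg conj h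
    simpa using this
  have ha' : c₁ * w + 2 * c₂ * (w ^ 2 + x) * conj w = 0 := by
      simpa [htwo] using congrArg conj ha
  have hb' : c₁ * z = 2 * c₂ * (w ^ 2 + x) * conj z := by
      simpa [htwo] using congrArg conj hb
  by_cases h1 : c₁ = 0
  · left
    have h2 : (c₂ : ℂ) ≠ 0 := by
      have := hc.resolve_left (not_not.2 h1)
      exact_mod_cast this
    rw [h1] at ha hb
    simp only [Complex.ofReal_zero, zero_mul, zero_add] at ha hb
    constructor
    · simpa [h2, hK'] using ha
    · simpa [h2, hK'] using hb.symm
  have h1c : (c₁ : ℂ) ≠ 0 := by exact_mod_cast h1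
  have hv0 : v = 0 := (mul_eq_zero.1 hv).resolve_left h1
  subst hv0
  by_cases hw0 : w = 0
  · subst hw0
    simp only [map_zero] at *
    by_cases hz0 : z = 0
    · exact Or.inl (by simp [hz0])
    right
    have hy : y = conj y := by
      apply mul_left_cancel₀ h1c
      linear_combination hd
    have h2c : (c₂ : ℂ) ≠ 0 := by
      intro h2
      rw [h2] at hb
      simp [h1, hz0] at hb
    refine squareRootType_of_real hz hx (by simp) ?_ (by simp)
    apply mul_left_cancel₀ (mul_ne_zero hrc h2c)
    linear_combination z / 2 * hb - conj z / 2 * hb' + c₂ * conj x * hz - c₂ * x * hz'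
      + c₂ * x * conj x * hy
  · right
    have hw0' : conj w ≠ 0 := by simpa using hw0
    have h2c : (c₂ : ℂ) ≠ 0 := by
      intro h2
      rw [h2] at ha
      simp [h1, hw0] at ha
    have hxw : x * conj w ^ 2 = conj x * w ^ 2 := by
      apply mul_left_cancel₀ (mul_ne_zero h2c (mul_ne_zero hw0 hw0'))
      linear_combination w * conj w ^ 2 / 2 * ha' - conj w * w ^ 2 / 2 * ha
    have hy : y = conj y := by
      apply mul_left_cancel₀ h1c
      linear_combination hd + 2 * c₂ * hxw
    have hzw : z * conj w + conj z * w = 0 := by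
      have h3 : c₁ * (z * conj w + conj z * w) = 0 := by
        by_cases hz0 : z = 0
        · simp [hz0]
        have hz0' : conj z ≠ 0 := by simpa using hz0
        apply mul_left_cancel₀ hw0
        linear_combination w ^ 2 * hb + z * w * ha
      exact (mul_eq_zero.1 h3).resolve_left h1c
    -- `M` is real and `w̄² M` is real and nonzero, so `w²` is real
    set M := (c₁ + 2 * c₂ * (w * conj w)) * y + 2 * c₂ * (z * conj z) with hM
    have hM1 : conj w ^ 2 * M = -2 * c₂ * (w * conj w) * r2 := by
      rw [hM]
      linear_combination conj w * y * ha + 2 * c₂ * conj w * conj z * hzw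
        - 2 * c₂ * w * conj w * hz'
    have hM2 : w ^ 2 * M = -2 * c₂ * (w * conj w) * r2 := by
      rw [hM]
      linear_combination w * y * ha' + 2 * c₂ * w * z * hzw
        - 2 * c₂ * w * conj w * hz - 2 * c₂ * (w * conj w) * x * hy
    have hM0 : M ≠ 0 := by
      intro h0
      rw [h0, mul_zero] at hM1
      simp [h2c, hw0, hr.ne'] at hM1
    have hw2 : w ^ 2 = conj w ^ 2 := by
      apply mul_right_cancel₀ hM0
      rw [hM1, hM2]
    have hxr : x = conj x := by
      apply mul_right_cancel₀ (pow_ne_zero 2 hw0')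
      linear_combination hxw + conj x * hw2
    have hzw' : z * w + conj z * conj w = 0 := by
      apply mul_right_cancel₀ hw0'
      linear_combination w * hzw - conj z * hw2
    refine squareRootType_of_real hz hx ?_ hxr hw2
    push_cast
    linear_combination (-conj x) * hzw' - conj z * conj w * hxr

/-! ### The types of critical points -/

/-- The critical points over the sheet `Σ₄` with parameter `s`: with `m = (ω₁, ω₂, ω₃ / 2)` one has
`α · m = -s ω₁`, `β · m = -s ω₂` and `s ω₃ m = (α + s e₁) × (β + s e₂)`. -/
def IsSheetFourPoint (s : ℝ) (x : Ambient) : Prop :=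
  x.2.1 0 * x.1 0 + x.2.1 1 * x.1 1 + x.2.1 2 * x.1 2 / 2 = -s * x.1 0 ∧
  x.2.2 0 * x.1 0 + x.2.2 1 * x.1 1 + x.2.2 2 * x.1 2 / 2 = -s * x.1 1 ∧
  s * x.1 2 * x.1 0 = x.2.1 1 * x.2.2 2 - x.2.1 2 * x.2.2 1 - s * x.2.1 2 ∧
  s * x.1 2 * x.1 1 = x.2.1 2 * x.2.2 0 - x.2.1 0 * x.2.2 2 - s * x.2.2 2 ∧
  s * x.1 2 ^ 2 / 2 = x.2.1 0 * x.2.2 1 - x.2.1 1 * x.2.2 0 + s * (x.2.1 0 + x.2.2 1) + s ^ 2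

/-- The critical points over the sheets `2 g = p² h ± r² √k`: there is a signed root `κ` of `K`
with `2 G = p² H + r² κ`. -/
def IsSquareRootPoint (a b : ℝ) (x : Ambient) : Prop :=
  ∃ κ : ℝ, κ ^ 2 = K x ∧ 2 * G a b x - (a ^ 2 + b ^ 2) * H x = (a ^ 2 - b ^ 2) * κ ∧
    |κ - (x.2.1 0 - x.2.2 1)| ≤ x.1 0 ^ 2 + x.1 1 ^ 2

/-- The pendulum motions: `ω₁ = ω₂ = 0` and `α`, `β` in the equatorial plane. -/
def IsPendulumPoint (x : Ambient) : Prop :=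
  x.1 0 = 0 ∧ x.1 1 = 0 ∧ x.2.1 2 = 0 ∧ x.2.2 2 = 0

theorem mem_P6_iff {a b : ℝ} {x : Ambient} : x ∈ P6 a b ↔
    x.2.1 0 ^ 2 + x.2.1 1 ^ 2 + x.2.1 2 ^ 2 = a ^ 2 ∧
    x.2.2 0 ^ 2 + x.2.2 1 ^ 2 + x.2.2 2 ^ 2 = b ^ 2 ∧
    x.2.1 0 * x.2.2 0 + x.2.1 1 * x.2.2 1 + x.2.1 2 * x.2.2 2 = 0 := by
  simp [P6, geom, Prod.ext_iff]

/-- The equations of a critical point: the combination of differentials vanishes along the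
coordinate directions of `ω` and along the rotations of the pair `(α, β)`. -/
theorem exists_multiplier_equations {a b : ℝ} {x : Ambient} (hx : x ∈ criticalSet a b) :
    ∃ c₁ c₂ c₃ : ℝ, (c₁, c₂, c₃) ≠ 0 ∧ ∀ o e : V3,
      c₁ * dH x (o, crossProduct e x.2.1, crossProduct e x.2.2)
        + c₂ * dK x (o, crossProduct e x.2.1, crossProduct e x.2.2)
        + c₃ * dG a b x (o, crossProduct e x.2.1, crossProduct e x.2.2) = 0 := by
  obtain ⟨c₁, c₂, c₃, hc, h⟩ := (rankJ_lt_three_iff a b x).1 hx.2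
  refine ⟨c₁, c₂, c₃, hc, fun o e => h _ ?_⟩
  rw [mem_tangent]
  simp only [cross_apply, Matrix.cons_val_zero, Matrix.cons_val_one, Matrix.cons_val]
  refine ⟨?_, ?_, ?_⟩ <;> ring

theorem isSquareRootPoint_of_complex {a b : ℝ} {x : Ambient} (hx : x ∈ P6 a b)
    (h : SquareRootType ⟨x.1 0, x.1 1⟩ ⟨x.2.1 0 - x.2.2 1, x.2.1 1 + x.2.2 0⟩
      ⟨x.2.1 0 + x.2.2 1, x.2.1 1 - x.2.2 0⟩ ⟨x.2.1 2, x.2.2 2⟩ (x.1 2) (a ^ 2 - b ^ 2)) :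
    IsSquareRootPoint a b x := by
  obtain ⟨hα, hβ, hαβ⟩ := mem_P6_iff.1 hx
  obtain ⟨κ, h1, h2, h3⟩ := h
  refine ⟨κ, ?_, ?_, ?_⟩
  · have := congrArg Complex.re h1
    simp [pow_two] at this
    simp only [K]
    linear_combination -this
  · rw [← hα, ← hβ] at h2
    have := congrArg Complex.re h2
    simp [pow_two] at this
    simp only [H, G_eq]
    rw [← hα, ← hβ]
    linear_combination this
  · rw [Complex.sq_norm, Complex.normSq_mk] at h3
    convert h3 using 1
    ring

/-- Every critical point has `K = 0` or belongs to one of three types. The multiplier equations are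
those of the complex classification, split into real and imaginary parts. -/
theorem critical_classification {a b : ℝ} (hb : 0 < b) (hab : b < a) {x : Ambient}
    (hx : x ∈ criticalSet a b) :
    K x = 0 ∨ IsSquareRootPoint a b x ∨ (∃ s, IsSheetFourPoint s x) ∨ IsPendulumPoint x := by
  by_cases hK0 : K x = 0
  · exact Or.inl hK0
  right
  have hr : 0 < a ^ 2 - b ^ 2 := by nlinarith
  obtain ⟨hα, hβ, hαβ⟩ := mem_P6_iff.1 hx.1
  have hsq := isSquareRootPoint_of_complex hx.1
  obtain ⟨c₁, c₂, c₃, hc, h⟩ := exists_multiplier_equations hx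
  obtain ⟨ω, α, β⟩ := x
  simp only at hα hβ hαβ hsq ⊢
  set w : ℂ := ⟨ω 0, ω 1⟩ with hw
  set X : ℂ := ⟨α 0 - β 1, α 1 + β 0⟩ with hX
  set Y : ℂ := ⟨α 0 + β 1, α 1 - β 0⟩ with hY
  set Z : ℂ := ⟨α 2, β 2⟩ with hZ
  have hz : Z ^ 2 + X * conj Y = ((a ^ 2 - b ^ 2 : ℝ) : ℂ) := by
    apply Complex.ext
    · simp [hX, hY, hZ, pow_two]
      linear_combination hα - hβ
    · simp [hX, hY, hZ, pow_two]
      linear_combination 2 * hαβ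
  have hW : w ^ 2 + X ≠ 0 := by
    intro h0
    apply hK0
    have h1 := congrArg Complex.re h0
    have h2 := congrArg Complex.im h0
    simp [hw, hX, pow_two] at h1 h2
    simp only [K]
    linear_combination (ω 0 ^ 2 - ω 1 ^ 2 + α 0 - β 1) * h1
      + (2 * ω 0 * ω 1 + α 1 + β 0) * h2
  by_cases h3 : c₃ = 0
  · subst h3
    have hc' : c₁ ≠ 0 ∨ c₂ ≠ 0 := by
      by_contra! hcon
      exact hc (by simp [hcon.1, hcon.2])
    have E0 := h ![1, 0, 0] 0
    have E1 := h ![0, 1, 0] 0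
    have E2 := h ![0, 0, 1] 0
    have R0 := h 0 ![1, 0, 0]
    have R1 := h 0 ![0, 1, 0]
    have R2 := h 0 ![0, 0, 1]
    clear h
    simp only [cross_apply, dH, dK, dG, Pi.zero_apply, Matrix.cons_val_zero, Matrix.cons_val_one,
      Matrix.cons_val] at E0 E1 E2 R0 R1 R2
    have := classification_of_H_K_multiplier (v := ω 2) hr hz hc' hW
      (by linear_combination E2)
      (by
        apply Complex.ext
        · simp [hw, hX, pow_two]
          linear_combination E0 / 2
        · simp [hw, hX, pow_two]
          linear_combination -E1 / 2)
      (by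
        apply Complex.ext
        · simp [hw, hX, hZ, pow_two]
          linear_combination -R1
        · simp [hw, hX, hZ, pow_two]
          linear_combination -R0)
      (by
        apply Complex.ext
        · simp [hw, hX, hY, pow_two]
          exact Or.inr (by ring)
        · simp [hw, hX, hY, pow_two]
          linear_combination 2 * R2)
    rcases this with ⟨hw0, hz0⟩ | hN
    · right; right
      have h1 := congrArg Complex.re hw0
      have h2 := congrArg Complex.im hw0
      have h3 := congrArg Complex.re hz0
      have h4 := congrArg Complex.im hz0
      exact ⟨h1, h2, h3, h4⟩
    · exact Or.inl (hsq hN)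
  · obtain ⟨l, hl⟩ : ∃ l, c₁ = c₃ * l := ⟨c₁ / c₃, by field_simp⟩
    obtain ⟨s, hs⟩ : ∃ s, c₂ = c₃ * (s / 2) := ⟨2 * c₂ / c₃, by field_simp⟩
    subst hl hs
    replace h : ∀ o e : V3, l * dH (ω, α, β) (o, crossProduct e α, crossProduct e β)
        + s / 2 * dK (ω, α, β) (o, crossProduct e α, crossProduct e β)
        + dG a b (ω, α, β) (o, crossProduct e α, crossProduct e β) = 0 := by
      intro o e
      apply mul_left_cancel₀ h3
      linear_combination h o e
    have E0 := h ![1, 0, 0] 0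
    have E1 := h ![0, 1, 0] 0
    have E2 := h ![0, 0, 1] 0
    have R0 := h 0 ![1, 0, 0]
    have R1 := h 0 ![0, 1, 0]
    have R2 := h 0 ![0, 0, 1]
    clear h
    simp only [cross_apply, dH, dK, dG, Pi.zero_apply, Matrix.cons_val_zero, Matrix.cons_val_one,
      Matrix.cons_val] at E0 E1 E2 R0 R1 R2
    rw [← hα, ← hβ] at R0 R1 R2
    have hd : ∀ D : ℂ, D.im = 0 → D = conj D := by
      intro D hD
      apply Complex.ext <;> simp [hD]
    have := classification_of_G_multiplier (v := ω 2) (s := s)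
      (μ := l + (α 0 ^ 2 + α 1 ^ 2 + α 2 ^ 2 + (β 0 ^ 2 + β 1 ^ 2 + β 2 ^ 2)) / 2) hr hz
      rfl rfl rfl rfl hW
      (by
        apply Complex.ext
        · simp [hw, hX, hY, hZ, pow_two]
          linear_combination E0
        · simp [hw, hX, hY, hZ, pow_two]
          linear_combination E1)
      (by
        apply Complex.ext
        · simp [hw, hX, hZ, pow_two]
          linear_combination 2 * E2
        · simp [hw, hX, hZ, pow_two]
          ring)
      (by
        apply Complex.ext
        · simp [hw, hX, hY, hZ, pow_two]
          linear_combination 2 * R1 + 2 * β 2 * hαβ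
        · simp [hw, hX, hY, hZ, pow_two]
          linear_combination 2 * R0 - 2 * α 2 * hαβ)
      (by
        apply hd
        simp [hw, hX, hY, hZ, pow_two]
        linear_combination -2 * R2 + (-2 * α 0 + 2 * β 1) * hαβ)
    rcases this with ⟨hT, hP, hq⟩ | ⟨hw0, hz0⟩ | hN
    · right; left
      have h1 := congrArg Complex.re hT
      have h2 := congrArg Complex.im hT
      have h3 := congrArg Complex.re hP
      have h4 := congrArg Complex.im hP
      have h5 := congrArg Complex.re hq
      simp [hw, hX, hY, hZ, pow_two] at h1 h2 h3 h4 h5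
      refine ⟨s, ?_, ?_, ?_, ?_, ?_⟩ <;> simp only
      · linear_combination h1 / 2
      · linear_combination h2 / 2
      · linear_combination h3 / 2
      · linear_combination h4 / 2
      · linear_combination h5 / 4
    · right; right
      have h1 := congrArg Complex.re hw0
      have h2 := congrArg Complex.im hw0
      have h3 := congrArg Complex.re hz0
      have h4 := congrArg Complex.im hz0
      exact ⟨h1, h2, h3, h4⟩
    · exact Or.inl (hsq hN)

/-! ### Admissible parameters -/

/-- The closed form of the two systems of inequalities: the pairs `(s, h)` for which the point of
the sheet with parameters `(s, h)` is a critical value. -/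
def Admissible (a b s h : ℝ) : Prop :=
  (-a ≤ s ∧ s ≤ -b ∧ s + a * b / s ≤ h) ∨
  (s ≠ 0 ∧ -b ≤ s ∧ s ≤ b ∧ hPlus a b s ≤ h) ∨
  (b ≤ s ∧ s ≤ a ∧ s - a * b / s ≤ h) ∨
  (a ≤ s ∧ s - a * b / s ≤ h ∧ h ≤ hMinus a b s)

theorem phi_nonneg (a b s : ℝ) : 0 ≤ phi a b s := Real.sqrt_nonneg _

theorem phi_le {a b s t : ℝ} (ht : 0 ≤ t) (hs : s ≠ 0)
    (h : (s ^ 2 - a ^ 2) * (s ^ 2 - b ^ 2) ≤ s ^ 2 * t ^ 2) : phi a b s ≤ t := by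
  refine Real.sqrt_le_iff.2 ⟨ht, ?_⟩
  rw [div_le_iff₀ (by positivity)]
  linarith

/-- Two ways of writing `s² φ(s)²` as a difference of squares. -/
theorem phi_le_abs {a b s : ℝ} (hs : s ≠ 0) :
    phi a b s ≤ |s + a * b / s| ∧ phi a b s ≤ |s - a * b / s| := by
  constructor
  · refine phi_le (abs_nonneg _) hs ?_
    rw [sq_abs]
    have : s ^ 2 * (s + a * b / s) ^ 2 = (s ^ 2 + a * b) ^ 2 := by field_simp
    rw [this]
    nlinarith [sq_nonneg (s * (a + b))]
  · refine phi_le (abs_nonneg _) hs ?_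
    rw [sq_abs]
    have : s ^ 2 * (s - a * b / s) ^ 2 = (s ^ 2 - a * b) ^ 2 := by field_simp
    rw [this]
    nlinarith [sq_nonneg (s * (a - b))]

theorem admissible_of_pos_of_eq_add {a b s h : ℝ} (hb : 0 < b) (hab : b < a) (hs : 0 < s)
    (hh : s * h = s ^ 2 + a * b) : Admissible a b s h := by
  have ha : 0 < a := hb.trans hab
  have he : h = s + a * b / s := by field_simp; linarith
  have h0 : 0 < a * b / s := by positivity
  have hφ := (phi_le_abs (a := a) (b := b) hs.ne').2
  rcases le_total s b with h1 | h1
  · refine Or.inr (Or.inl ⟨hs.ne', by linarith, h1, ?_⟩)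
    have : s ≤ a * b / s := by rw [le_div_iff₀ hs]; nlinarith
    rw [abs_of_nonpos (by linarith)] at hφ
    rw [hPlus]; linarith
  rcases le_total s a with h2 | h2
  · exact Or.inr (Or.inr (Or.inl ⟨h1, h2, by linarith⟩))
  · refine Or.inr (Or.inr (Or.inr ⟨h2, by linarith, ?_⟩))
    have : a * b / s ≤ s := by rw [div_le_iff₀ hs]; nlinarith
    rw [abs_of_nonneg (by linarith)] at hφ
    rw [hMinus]; linarith

theorem admissible_of_eq_sub {a b s h : ℝ} (hb : 0 < b) (hab : b < a)
    (hs : b ≤ s ∨ (-a ≤ s ∧ s < 0))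
    (hh : s * h = s ^ 2 - a * b) : Admissible a b s h := by
  have ha : 0 < a := hb.trans hab
  have hs0 : s ≠ 0 := by rcases hs with h | h <;> intro h0 <;> linarith
  have he : h = s - a * b / s := by field_simp; linarith
  have hφ := (phi_le_abs (a := a) (b := b) hs0).1
  rcases hs with hs | ⟨hs1, hs2⟩
  · rcases le_total s a with h2 | h2
    · exact Or.inr (Or.inr (Or.inl ⟨hs, h2, by linarith⟩))
    · refine Or.inr (Or.inr (Or.inr ⟨h2, by linarith, ?_⟩))
      have : 0 < a * b / s := by have := hb.trans_le hs; positivity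
      rw [abs_of_nonneg (by linarith)] at hφ
      rw [hMinus]; linarith
  · have h0 : a * b / s < 0 := div_neg_of_pos_of_neg (by positivity) hs2
    rcases le_total s (-b) with h1 | h1
    · exact Or.inl ⟨hs1, h1, by linarith⟩
    · refine Or.inr (Or.inl ⟨hs0, h1, by linarith, ?_⟩)
      rw [abs_of_nonpos (by linarith)] at hφ
      rw [hPlus]; linarith

/-- A criterion for admissibility: the energy is at least `-(a + b)`, `|h - 2 s| ≥ φ(s)`
where `φ` makes sense, and the sign of `h - 2 s` is the right one. -/
theorem admissible_of_bounds {a b s h : ℝ} (hb : 0 < b) (hab : b < a) (hs : s ≠ 0)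
    (hh : -(a + b) ≤ h) (hk : (s ^ 2 - a ^ 2) * (s ^ 2 - b ^ 2) ≤ s ^ 2 * (h - 2 * s) ^ 2)
    (hbig : a ^ 2 < s ^ 2 → h - 2 * s ≤ 0) (hsmall : s ^ 2 < b ^ 2 → 0 ≤ h - 2 * s)
    (hpos : b ≤ s → s ^ 2 - a * b ≤ s * h) (hneg : s ≤ -b → s * h ≤ s ^ 2 + a * b) :
    Admissible a b s h := by
  rcases lt_or_ge s (-a) with c1 | c1
  · have := hbig (by nlinarith)
    linarith
  rcases le_or_gt s (-b) with c2 | c2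
  · refine Or.inl ⟨c1, c2, ?_⟩
    have hs0 : s < 0 := by linarith
    have : a * b / s ≤ h - s := by
      rw [div_le_iff_of_neg hs0]
      linarith [hneg c2]
    linarith
  rcases lt_or_ge s b with c3 | c3
  · refine Or.inr (Or.inl ⟨hs, c2.le, c3.le, ?_⟩)
    have := phi_le (hsmall (by nlinarith)) hs hk
    rw [hPlus]; linarith
  have hs0 : 0 < s := by linarith
  have hlow : s - a * b / s ≤ h := by
    rw [sub_le_iff_le_add, ← sub_le_iff_le_add', le_div_iff₀ hs0]
    linarith [hpos c3]
  rcases le_or_gt s a with c4 | c4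
  · exact Or.inr (Or.inr (Or.inl ⟨c3, c4, hlow⟩))
  · refine Or.inr (Or.inr (Or.inr ⟨c4.le, hlow, ?_⟩))
    have : phi a b s ≤ -(h - 2 * s) :=
      phi_le (neg_nonneg.2 (hbig (by nlinarith))) hs (by rw [neg_sq]; exact hk)
    rw [hMinus]; linarith

/-- If two different parameters give the same point of the sheet, then
`ψ(X) = (X² - h X ± a b)²`, and the two parameters are the roots of the inner polynomial. -/
theorem sheet4Param_eq_sheet4Param {a b s s' h : ℝ} (hs : s ≠ 0) (hs' : s' ≠ 0) (hne : s ≠ s')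
    (he : sheet4Param a b s h = sheet4Param a b s' h) :
    s + s' = h ∧ (s * s' = a * b ∨ s * s' = -(a * b)) := by
  simp only [sheet4Param, Prod.mk.injEq, true_and] at he
  obtain ⟨hk, hg⟩ := he
  have hd : s - s' ≠ 0 := sub_ne_zero.2 hne
  have h1 : (3 * (s * s') ^ 2 + (a * b) ^ 2) * (s + s') = 4 * h * (s * s') ^ 2 := by
    field_simp at hk
    apply mul_left_cancel₀ hd
    linear_combination hk
  have h2 : h * (s + s') * (s * s') = (s ^ 2 + s * s' + s' ^ 2) * (s * s') + (a * b) ^ 2 := by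
    field_simp at hg
    apply mul_left_cancel₀ hd
    linear_combination hg
  have h3 : (s * s') ^ 2 = (a * b) ^ 2 := by
    apply mul_left_cancel₀ (pow_ne_zero 2 hd)
    linear_combination (-(s + s')) * h1 - 4 * (s * s') * h2
  refine ⟨?_, sq_eq_sq_iff_eq_or_eq_neg.1 h3⟩
  apply mul_left_cancel₀ (pow_ne_zero 2 (mul_ne_zero hs hs'))
  linear_combination h1 / 4 + (s + s') / 4 * h3

/-- Admissibility depends only on the point of the sheet, also where the parametrization is not
injective. -/
theorem Admissible.congr_param {a b s s' h : ℝ} (hb : 0 < b) (hab : b < a) (hs : s ≠ 0)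
    (hs' : s' ≠ 0) (he : sheet4Param a b s h = sheet4Param a b s' h)
    (hadm : Admissible a b s' h) : Admissible a b s h := by
  rcases eq_or_ne s s' with rfl | hne
  · exact hadm
  have ha : 0 < a := hb.trans hab
  have habp : 0 < a * b := by positivity
  obtain ⟨h1, h2 | h2⟩ := sheet4Param_eq_sheet4Param hs hs' hne he
  · rcases hs.lt_or_gt with hneg | hpos
    · have hs'n : s' < 0 := by nlinarith
      have h5 : s * h = s ^ 2 + a * b := by rw [← h1, ← h2]; ring
      have h6 : h = s + a * b / s := by field_simp; linarith
      rcases hadm with ⟨h3, h4, -⟩ | ⟨-, h3, -, h4⟩ | ⟨h3, -⟩ | ⟨h3, -⟩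
      · refine Or.inl ⟨?_, ?_, h6.ge⟩ <;> nlinarith
      · have := phi_nonneg a b s'
        rw [hPlus] at h4
        nlinarith
      · linarith
      · linarith
    · exact admissible_of_pos_of_eq_add hb hab hpos (by rw [← h1, ← h2]; ring)
  · have h5 : s * h = s ^ 2 - a * b := by rw [← h1]; linear_combination h2
    refine admissible_of_eq_sub hb hab ?_ h5
    rcases hs.lt_or_gt with hneg | hpos
    · right
      refine ⟨?_, hneg⟩
      have hs'p : 0 < s' := by nlinarith
      rcases hadm with ⟨-, h3, -⟩ | ⟨-, -, h3, h4⟩ | ⟨h3, -⟩ | ⟨h3, -⟩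
      · linarith
      · have := phi_nonneg a b s'
        rw [hPlus] at h4
        linarith
      · nlinarith
      · nlinarith
    · left
      have hs'n : s' < 0 := by nlinarith
      rcases hadm with ⟨h3, -⟩ | ⟨-, h3, -⟩ | ⟨h3, -⟩ | ⟨h3, -⟩ <;> nlinarith

/-! ### Critical values on the sheet have admissible parameters -/

theorem sq_le_of_mem_P6 {a b : ℝ} {x : Ambient} (hx : x ∈ P6 a b) :
    x.2.1 0 ^ 2 ≤ a ^ 2 ∧ x.2.2 1 ^ 2 ≤ b ^ 2 := by
  obtain ⟨hα, hβ, -⟩ := mem_P6_iff.1 hx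
  constructor <;> nlinarith [sq_nonneg (x.2.1 1), sq_nonneg (x.2.1 2), sq_nonneg (x.2.2 0),
    sq_nonneg (x.2.2 2)]

theorem neg_add_le_H {a b : ℝ} (hb : 0 < b) (hab : b < a) {x : Ambient} (hx : x ∈ P6 a b) :
    -(a + b) ≤ H x := by
  obtain ⟨h1, h2⟩ := sq_le_of_mem_P6 hx
  have h3 := abs_le_of_sq_le_sq' h1 (by linarith)
  have h4 := abs_le_of_sq_le_sq' h2 (by linarith)
  simp only [H]
  nlinarith [sq_nonneg (x.1 0), sq_nonneg (x.1 1), sq_nonneg (x.1 2), h3.2, h4.2]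

/-- The values of the integrals at a point over the sheet. -/
theorem IsSheetFourPoint.J_eq {a b s : ℝ} (hb : 0 < b) (hab : b < a) {x : Ambient}
    (hx : x ∈ P6 a b) (h : IsSheetFourPoint s x) : s ≠ 0 ∧ J a b x = sheet4Param a b s (H x) := by
  obtain ⟨hα, hβ, hαβ⟩ := mem_P6_iff.1 hx
  obtain ⟨ω, α, β⟩ := x
  obtain ⟨h1, h2, h3, h4, h5⟩ := h
  simp only at *
  have ha : 0 < a := hb.trans hab
  have hs : s ≠ 0 := by
    rintro rfl
    have hγ : 0 < a ^ 2 * b ^ 2 := by positivity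
    rw [← hα, ← hβ] at hγ
    simp only [zero_mul, zero_div, sub_zero, add_zero, ne_eq, OfNat.ofNat_ne_zero,
      not_false_eq_true, zero_pow] at h3 h4 h5
    have : (α 0 ^ 2 + α 1 ^ 2 + α 2 ^ 2) * (β 0 ^ 2 + β 1 ^ 2 + β 2 ^ 2) = 0 := by
      linear_combination (α 0 * β 0 + α 1 * β 1 + α 2 * β 2) * hαβ
        - (α 1 * β 2 - α 2 * β 1) * h3 - (α 2 * β 0 - α 0 * β 2) * h4
        - (α 0 * β 1 - α 1 * β 0) * h5
    linarith
  refine ⟨hs, ?_⟩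
  simp only [J, sheet4Param, Prod.mk.injEq, true_and]
  constructor
  · have key : s ^ 2 * ((H (ω, α, β) - 2 * s) ^ 2 - K (ω, α, β))
        = (s ^ 2 - a ^ 2) * (s ^ 2 - b ^ 2) := by
      rw [← hα, ← hβ]
      simp only [H, K]
      linear_combination (-4 * s ^ 2 * ω 0) * h1 - 4 * s ^ 2 * ω 1 * h2
        + (s * ω 2 * ω 0 + (α 1 * β 2 - α 2 * β 1 - s * α 2) + 2 * s * α 2) * h3
        + (s * ω 2 * ω 1 + (α 2 * β 0 - α 0 * β 2 - s * β 2) + 2 * s * β 2) * h4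
        + (s * ω 2 ^ 2 / 2 + (α 0 * β 1 - α 1 * β 0 + s * (α 0 + β 1) + s ^ 2)
          - 2 * s * (α 0 + β 1 + 2 * s)) * h5
        - (α 0 * β 0 + α 1 * β 1 + α 2 * β 2) * hαβ
    field_simp
    linear_combination -key
  · have key : s * G a b (ω, α, β) = s ^ 2 * (s * H (ω, α, β) - s ^ 2) + a ^ 2 * b ^ 2 := by
      rw [G_eq, ← hα, ← hβ]
      simp only [H]
      linear_combination
        s * (α 0 * ω 0 + α 1 * ω 1 + α 2 * ω 2 / 2 - s * ω 0) * h1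
        + s * (β 0 * ω 0 + β 1 * ω 1 + β 2 * ω 2 / 2 - s * ω 1) * h2
        + (α 1 * β 2 - α 2 * β 1) * h3 + (α 2 * β 0 - α 0 * β 2) * h4
        + (α 0 * β 1 - α 1 * β 0) * h5 - s ^ 2 * h5
        - (α 0 * β 0 + α 1 * β 1 + α 2 * β 2 + s * α 1 + s * β 0) * hαβ
    field_simp
    linear_combination key

/-- The sum cannot vanish for `|s| < b`: this would force `α₁ = β₂ = -s`, `α₂ = β₁ = 0`, hence
`α₃ ≠ 0` and `β₃ ≠ 0`, against `α · β = 0`. -/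
theorem sum_sq_pos_of_sq_lt {a b s a₀ a₁ a₂ b₀ b₁ b₂ : ℝ} (hb : 0 < b) (hab : b < a)
    (hα : a₀ ^ 2 + a₁ ^ 2 + a₂ ^ 2 = a ^ 2) (hβ : b₀ ^ 2 + b₁ ^ 2 + b₂ ^ 2 = b ^ 2)
    (hαβ : a₀ * b₀ + a₁ * b₁ + a₂ * b₂ = 0) (hs : s ^ 2 < b ^ 2) :
    0 < (a ^ 2 - s ^ 2) * (b₀ ^ 2 + (b₁ + s) ^ 2) + (b ^ 2 - s ^ 2) * ((a₀ + s) ^ 2 + a₁ ^ 2) := by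
  have hsa : s ^ 2 < a ^ 2 := by nlinarith
  have p1 := mul_nonneg (sub_nonneg.2 hsa.le) (by positivity : 0 ≤ b₀ ^ 2 + (b₁ + s) ^ 2)
  have p2 := mul_nonneg (sub_nonneg.2 hs.le) (by positivity : 0 ≤ (a₀ + s) ^ 2 + a₁ ^ 2)
  by_contra! hcon
  have e1 : (a₀ + s) ^ 2 + a₁ ^ 2 = 0 :=
    (mul_eq_zero.1 (le_antisymm (by linarith) p2)).resolve_left (by linarith)
  have e2 : b₀ ^ 2 + (b₁ + s) ^ 2 = 0 :=
    (mul_eq_zero.1 (le_antisymm (by linarith) p1)).resolve_left (by linarith)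
  have f1 : a₀ + s = 0 := by
    rw [← sq_eq_zero_iff]; linarith [sq_nonneg (a₀ + s), sq_nonneg a₁]
  have f2 : a₁ = 0 := by
    rw [← sq_eq_zero_iff]; linarith [sq_nonneg (a₀ + s), sq_nonneg a₁]
  have f3 : b₀ = 0 := by
    rw [← sq_eq_zero_iff]; linarith [sq_nonneg (b₁ + s), sq_nonneg b₀]
  have f4 : b₁ + s = 0 := by
    rw [← sq_eq_zero_iff]; linarith [sq_nonneg (b₁ + s), sq_nonneg b₀]
  obtain rfl : a₀ = -s := by linarith
  obtain rfl : b₁ = -s := by linarith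
  subst f2 f3
  have g1 : 0 < a₂ ^ 2 := by linarith
  have g2 : 0 < b₂ ^ 2 := by linarith
  have g3 : a₂ * b₂ = 0 := by linarith
  have := mul_pos g1 g2
  rw [← mul_pow, g3] at this
  simp at this

theorem sum_sq_neg_of_lt_sq {a b s a₀ a₁ a₂ : ℝ} (hb : 0 < b) (hab : b < a)
    (hα : a₀ ^ 2 + a₁ ^ 2 + a₂ ^ 2 = a ^ 2) (hs : a ^ 2 < s ^ 2) (b₀ b₁ : ℝ) :
    (a ^ 2 - s ^ 2) * (b₀ ^ 2 + (b₁ + s) ^ 2) + (b ^ 2 - s ^ 2) * ((a₀ + s) ^ 2 + a₁ ^ 2) < 0 := by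
  have hsb : b ^ 2 < s ^ 2 := by nlinarith
  have h1 : a₀ + s ≠ 0 := by
    intro h
    obtain rfl : a₀ = -s := by linarith
    linarith [sq_nonneg a₁, sq_nonneg a₂, neg_sq s]
  have p1 := mul_nonneg (sub_nonneg.2 hs.le) (by positivity : 0 ≤ b₀ ^ 2 + (b₁ + s) ^ 2)
  have p2 := mul_pos (sub_pos.2 hsb) (by positivity : 0 < (a₀ + s) ^ 2 + a₁ ^ 2)
  linarith

/-- The sign of `h - 2 s` at a point over the sheet is read off from a sum of squares with
coefficients `a² - s²` and `b² - s²`. -/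
theorem IsSheetFourPoint.admissible {a b s : ℝ} (hb : 0 < b) (hab : b < a) {x : Ambient}
    (hx : x ∈ P6 a b) (h : IsSheetFourPoint s x) : Admissible a b s (H x) := by
  obtain ⟨hs, hJ⟩ := h.J_eq hb hab hx
  have hH := neg_add_le_H hb hab hx
  have ha : 0 < a := hb.trans hab
  obtain ⟨hα, hβ, hαβ⟩ := mem_P6_iff.1 hx
  have hk : s ^ 2 * ((H x - 2 * s) ^ 2 - K x) = (s ^ 2 - a ^ 2) * (s ^ 2 - b ^ 2) := by
    have := congrArg (fun y => y.2.1) hJ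
    simp only [J, sheet4Param] at this
    rw [this]
    field_simp
    ring
  have hK : 0 ≤ K x := by simp only [K]; positivity
  have hkle : (s ^ 2 - a ^ 2) * (s ^ 2 - b ^ 2) ≤ s ^ 2 * (H x - 2 * s) ^ 2 := by
    have : 0 ≤ s ^ 2 * K x := by positivity
    linarith
  clear hJ
  obtain ⟨ω, α, β⟩ := x
  obtain ⟨h1, h2, h3, h4, h5⟩ := h
  simp only at *
  set t := H (ω, α, β) - 2 * s with ht
  have hsq : s ^ 2 * ω 2 ^ 2 * t = (a ^ 2 - s ^ 2) * (β 0 ^ 2 + (β 1 + s) ^ 2)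
      + (b ^ 2 - s ^ 2) * ((α 0 + s) ^ 2 + α 1 ^ 2) := by
    rw [ht, ← hα, ← hβ]
    simp only [H]
    linear_combination
      (s * ω 2 * ω 0 + (α 1 * β 2 - α 2 * β 1 - s * α 2)) * h3
      + (s * ω 2 * ω 1 + (α 2 * β 0 - α 0 * β 2 - s * β 2)) * h4
      + 2 * (s * ω 2 ^ 2 / 2 + (α 0 * β 1 - α 1 * β 0 + s * (α 0 + β 1) + s ^ 2)) * h5
      - 2 * s * (α 0 + β 1 + 2 * s) * h5
      - (2 * (α 0 * β 0 + α 1 * β 1) + 2 * s * α 1 + 2 * s * β 0) * hαβ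
  have hγ : (α 0 * β 1 - α 1 * β 0) ^ 2 ≤ (a * b) ^ 2 := by
    have e : (a * b) ^ 2 = (α 0 * β 1 - α 1 * β 0) ^ 2 + (α 1 * β 2 - α 2 * β 1) ^ 2
        + (α 2 * β 0 - α 0 * β 2) ^ 2 := by
      rw [mul_pow, ← hα, ← hβ]
      linear_combination (α 0 * β 0 + α 1 * β 1 + α 2 * β 2) * hαβ
    linarith [sq_nonneg (α 1 * β 2 - α 2 * β 1), sq_nonneg (α 2 * β 0 - α 0 * β 2)]
  obtain ⟨hγ1, hγ2⟩ := abs_le_of_sq_le_sq' hγ (by positivity)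
  have hh : s * H (ω, α, β) = s ^ 2 + (α 0 * β 1 - α 1 * β 0) + s * (ω 0 ^ 2 + ω 1 ^ 2) := by
    simp only [H]
    linear_combination h5
  have hw : 0 ≤ ω 0 ^ 2 + ω 1 ^ 2 := by positivity
  have hsv : 0 ≤ s ^ 2 * ω 2 ^ 2 := by positivity
  have hbig : a ^ 2 < s ^ 2 → t ≤ 0 := by
    intro hsa
    have := sum_sq_neg_of_lt_sq hb hab hα hsa (β 0) (β 1)
    by_contra! hcon
    linarith [mul_nonneg hsv hcon.le]
  have hsmall : s ^ 2 < b ^ 2 → 0 ≤ t := by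
    intro hsb
    have := sum_sq_pos_of_sq_lt hb hab hα hβ hαβ hsb
    by_contra! hcon
    linarith [mul_nonpos_of_nonneg_of_nonpos hsv hcon.le]
  refine admissible_of_bounds hb hab hs hH hkle hbig hsmall (fun hs0 => ?_) (fun hs0 => ?_)
  · linarith [mul_nonneg (hb.trans_le hs0).le hw]
  · linarith [mul_nonneg (neg_nonneg.2 (hs0.trans (neg_nonpos.2 hb.le))) hw]

/-- A critical value on the sheet that comes from `K = 0`. -/
theorem admissible_of_K_eq_zero {a b s h : ℝ} (hb : 0 < b) (hab : b < a) {x : Ambient}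
    (hx : x ∈ P6 a b) (hK : K x = 0) (hs : s ≠ 0) (hJ : J a b x = sheet4Param a b s h) :
    Admissible a b s h := by
  have ha : 0 < a := hb.trans hab
  have hH := neg_add_le_H hb hab hx
  have hG : 2 * G a b x ≤ (a ^ 2 + b ^ 2) * H x := by
    obtain ⟨hα, hβ, hαβ⟩ := mem_P6_iff.1 hx
    obtain ⟨ω, α, β⟩ := x
    simp only [K] at hK hα hβ hαβ
    have h1 : ω 0 ^ 2 - ω 1 ^ 2 + α 0 - β 1 = 0 := by
      rw [← sq_eq_zero_iff]
      linarith [sq_nonneg (ω 0 ^ 2 - ω 1 ^ 2 + α 0 - β 1),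
        sq_nonneg (2 * ω 0 * ω 1 + α 1 + β 0)]
    have h2 : 2 * ω 0 * ω 1 + α 1 + β 0 = 0 := by
      rw [← sq_eq_zero_iff]
      linarith [sq_nonneg (ω 0 ^ 2 - ω 1 ^ 2 + α 0 - β 1),
        sq_nonneg (2 * ω 0 * ω 1 + α 1 + β 0)]
    have h3 : 2 * G a b (ω, α, β) - (a ^ 2 + b ^ 2) * H (ω, α, β)
        = -(ω 2 * (ω 0 ^ 2 + ω 1 ^ 2) + 2 * (α 2 * ω 0 + β 2 * ω 1)) ^ 2 / 2 := by
      rw [G_eq, ← hα, ← hβ]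
      simp only [H]
      linear_combination
        (-α 0 * ω 2 ^ 2 / 2 + α 0 ^ 2 + 4 * α 1 * ω 0 * ω 1 + α 1 ^ 2 + 2 * α 2 * ω 2 * ω 0
          + α 2 ^ 2 - β 0 ^ 2 + β 1 * ω 2 ^ 2 / 2 - β 1 ^ 2 - 2 * β 2 * ω 2 * ω 1 - β 2 ^ 2
          + ω 2 ^ 2 * ω 0 ^ 2 / 2 - ω 2 ^ 2 * ω 1 ^ 2 / 2 - 4 * ω 0 * ω 1 * β 0) * h1
        + (-α 1 * ω 2 ^ 2 / 2 - 2 * α 1 * ω 0 ^ 2 + 2 * α 1 * ω 1 ^ 2 + 2 * α 2 * ω 2 * ω 1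
          - β 0 * ω 2 ^ 2 / 2 + 2 * β 0 * ω 0 ^ 2 - 2 * β 0 * ω 1 ^ 2 + 4 * β 1 * ω 0 * ω 1
          + 2 * β 2 * ω 2 * ω 0 + ω 2 ^ 2 * ω 0 * ω 1 - 4 * ω 0 * ω 1 * β 1) * h2
        + 4 * ω 0 * ω 1 * hαβ
    linarith [sq_nonneg (ω 2 * (ω 0 ^ 2 + ω 1 ^ 2) + 2 * (α 2 * ω 0 + β 2 * ω 1))]
  simp only [J, sheet4Param, Prod.mk.injEq] at hJ
  obtain ⟨e1, e2, e3⟩ := hJ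
  rw [e1] at hH
  rw [hK] at e2
  rw [e1, e3] at hG
  have hk : (s ^ 2 - a ^ 2) * (s ^ 2 - b ^ 2) = s ^ 2 * (h - 2 * s) ^ 2 := by
    field_simp at e2
    linear_combination e2
  clear e1 e2 e3
  obtain ⟨t, rfl⟩ : ∃ t, h = t + 2 * s := ⟨h - 2 * s, by ring⟩
  rw [add_sub_cancel_right] at hk
  have hprod : t * (2 * s ^ 2 - (a ^ 2 + b ^ 2) + 2 * s * t) ≤ 0 := by
    have e : t * (2 * s ^ 2 - (a ^ 2 + b ^ 2) + 2 * s * t)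
        = 2 * (s ^ 2 * (t + 2 * s - s) + (a * b) ^ 2 / s) - (a ^ 2 + b ^ 2) * (t + 2 * s) := by
      field_simp
      linear_combination (-2) * hk
    linarith
  have hlt : (2 * s * t) ^ 2 < (2 * s ^ 2 - (a ^ 2 + b ^ 2)) ^ 2 := by
    have : 0 < (a ^ 2 - b ^ 2) ^ 2 := by
      have : 0 < a ^ 2 - b ^ 2 := by nlinarith
      positivity
    nlinarith
  have hout : s ^ 2 ≤ b ^ 2 ∨ a ^ 2 ≤ s ^ 2 := by
    by_contra! hcon
    have := mul_pos (sub_pos.2 hcon.2) (sub_pos.2 hcon.1)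
    nlinarith [mul_nonneg (sq_nonneg s) (sq_nonneg t)]
  have hba : b ^ 2 < a ^ 2 := by nlinarith
  have hbig : a ^ 2 ≤ s ^ 2 → t ≤ 0 := by
    intro h1
    have h2 := abs_lt_of_sq_lt_sq' hlt (by linarith)
    by_contra! hcon
    have := mul_pos hcon (by linarith [h2.1] : 0 < 2 * s ^ 2 - (a ^ 2 + b ^ 2) + 2 * s * t)
    linarith
  have hsmall : s ^ 2 ≤ b ^ 2 → 0 ≤ t := by
    intro h1
    rw [← neg_sq (2 * s ^ 2 - _)] at hlt
    have h2 := abs_lt_of_sq_lt_sq' hlt (by linarith)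
    by_contra! hcon
    have := mul_pos_of_neg_of_neg hcon
      (by linarith [h2.2] : 2 * s ^ 2 - (a ^ 2 + b ^ 2) + 2 * s * t < 0)
    linarith
  have hst : (s * t) ^ 2 ≤ (s ^ 2 + a * b) ^ 2 := by
    rw [mul_pow, ← hk]
    nlinarith [sq_nonneg (s * (a + b))]
  have hst' := abs_le_of_sq_le_sq' hst (by positivity)
  refine admissible_of_bounds hb hab hs hH (le_of_eq ?_) (fun h1 => ?_) (fun h1 => ?_)
    (fun h1 => ?_) (fun h1 => ?_)
  · rw [hk]; ring
  · linarith [hbig h1.le]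
  · linarith [hsmall h1.le]
  · linarith [hst'.1]
  · rcases hout with h2 | h2
    · have : s = -b := by nlinarith
      subst this
      have := hsmall (by linarith [neg_sq b])
      nlinarith
    · have := hbig h2
      nlinarith

/-- A critical value on the intersection of the sheet with the sheets `2 g = p² h ± r² √k`. The
two surfaces touch along `2 s h = 2 s² + p²` and cross along `s = ±a` and `s = ±b`. -/
theorem IsSquareRootPoint.admissible {a b s h : ℝ} (hb : 0 < b) (hab : b < a) {x : Ambient}
    (hx : x ∈ P6 a b) (hN : IsSquareRootPoint a b x) (hs : s ≠ 0)
    (hJ : J a b x = sheet4Param a b s h) : Admissible a b s h := by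
  have ha : 0 < a := hb.trans hab
  have hH := neg_add_le_H hb hab hx
  obtain ⟨κ, hκ, hQ, hb1⟩ := hN
  obtain ⟨hα, hβ⟩ := sq_le_of_mem_P6 hx
  have hα' := abs_le_of_sq_le_sq' hα ha.le
  have hβ' := abs_le_of_sq_le_sq' hβ hb.le
  obtain ⟨hb2, hb3⟩ := abs_le.1 hb1
  have hκ1 : κ - 2 * a ≤ H x := by
    simp only [H]
    linarith [sq_nonneg (x.1 2), hα'.2]
  have hκ2 : -κ - 2 * b ≤ H x := by
    simp only [H]
    linarith [sq_nonneg (x.1 2), hβ'.2]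
  have hr : 0 < a ^ 2 - b ^ 2 := by nlinarith
  simp only [J, sheet4Param, Prod.mk.injEq] at hJ
  obtain ⟨e1, e2, e3⟩ := hJ
  rw [e1] at hH hκ1 hκ2
  rw [e1, e3] at hQ
  rw [e2] at hκ
  clear e1 e2 e3 hx hα hβ hα' hβ' hb1 hb2 hb3
  have hk : s ^ 2 * κ ^ 2 = s ^ 2 * (h - 2 * s) ^ 2 - (s ^ 2 - a ^ 2) * (s ^ 2 - b ^ 2) := by
    rw [hκ]
    field_simp
    ring
  have hQ' : s * ((a ^ 2 - b ^ 2) * κ) = s * (h - 2 * s) * (2 * s ^ 2 - (a ^ 2 + b ^ 2))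
      + 2 * ((s ^ 2 - a ^ 2) * (s ^ 2 - b ^ 2)) := by
    rw [← hQ]
    field_simp
    ring
  have hD : (s ^ 2 - a ^ 2) * (s ^ 2 - b ^ 2)
      * (2 * s * (h - 2 * s) + 2 * s ^ 2 - (a ^ 2 + b ^ 2)) ^ 2 = 0 := by
    linear_combination (a ^ 2 - b ^ 2) ^ 2 * hk
      - (s * ((a ^ 2 - b ^ 2) * κ) + s * (h - 2 * s) * (2 * s ^ 2 - (a ^ 2 + b ^ 2))
      + 2 * ((s ^ 2 - a ^ 2) * (s ^ 2 - b ^ 2))) * hQ'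
  clear hQ hκ
  have hrs : (a ^ 2 - b ^ 2) * s ≠ 0 := mul_ne_zero hr.ne' hs
  rcases mul_eq_zero.1 hD with h0 | h0
  · rcases mul_eq_zero.1 h0 with h1 | h1
    · have hκt : κ = h - 2 * s := by
        apply mul_left_cancel₀ hrs
        have hs2 : s ^ 2 = a ^ 2 := by linarith
        rw [h0, hs2] at hQ'
        linear_combination hQ'
      rcases sq_eq_sq_iff_eq_or_eq_neg.1 (sub_eq_zero.1 h1) with rfl | rfl
      · refine Or.inr (Or.inr (Or.inl ⟨hab.le, le_rfl, ?_⟩))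
        rw [mul_div_cancel_left₀ _ ha.ne']
        linarith
      · refine Or.inl ⟨le_rfl, by linarith, ?_⟩
        rw [div_neg, mul_div_cancel_left₀ _ ha.ne']
        linarith
    · have hκt : κ = -(h - 2 * s) := by
        apply mul_left_cancel₀ hrs
        have hs2 : s ^ 2 = b ^ 2 := by linarith
        rw [h0, hs2] at hQ'
        linear_combination hQ'
      rcases sq_eq_sq_iff_eq_or_eq_neg.1 (sub_eq_zero.1 h1) with rfl | rfl
      · refine Or.inr (Or.inr (Or.inl ⟨le_rfl, hab.le, ?_⟩))
        rw [mul_div_cancel_right₀ _ hb.ne']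
        linarith
      · refine Or.inl ⟨by linarith, le_rfl, ?_⟩
        rw [div_neg, mul_div_cancel_right₀ _ hb.ne']
        linarith
  · have h1 : 2 * s * (h - 2 * s) + 2 * s ^ 2 - (a ^ 2 + b ^ 2) = 0 := by
      simpa using h0
    have hs0 : 0 < s := by
      by_contra! hcon
      have h2 : s * h ≤ s * (-(a + b)) := mul_le_mul_of_nonpos_left hH hcon
      nlinarith [sq_nonneg (2 * s + (a + b)), sq_nonneg (a - b), sub_pos.2 hab]
    refine admissible_of_bounds hb hab hs hH ?_ (fun h2 => ?_) (fun h2 => ?_)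
      (fun h2 => ?_) (fun h2 => ?_)
    · linarith [mul_nonneg (sq_nonneg s) (sq_nonneg κ)]
    · by_contra! hcon
      have := mul_pos hs0 hcon
      nlinarith
    · by_contra! hcon
      have := mul_neg_of_pos_of_neg hs0 hcon
      nlinarith
    · have : 0 < a * b := by positivity
      nlinarith
    · linarith

theorem mem_of_mul_nonpos {p q s : ℝ} (hpq : p < q) (h : (s - p) * (s - q) ≤ 0) :
    p ≤ s ∧ s ≤ q := by
  constructor <;> by_contra! hcon <;> nlinarith

/-- A critical value on the sheet that comes from a pendulum motion: there
`ψ(X) = (X² - h X + δ)²` with `δ = ±a b`. -/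
theorem IsPendulumPoint.admissible {a b s h : ℝ} (hb : 0 < b) (hab : b < a) {x : Ambient}
    (hx : x ∈ P6 a b) (hP : IsPendulumPoint x) (hs : s ≠ 0)
    (hJ : J a b x = sheet4Param a b s h) : Admissible a b s h := by
  have ha : 0 < a := hb.trans hab
  have hH := neg_add_le_H hb hab hx
  obtain ⟨hα, hβ, hαβ⟩ := mem_P6_iff.1 hx
  obtain ⟨ω, α, β⟩ := x
  obtain ⟨h1, h2, h3, h4⟩ := hP
  simp only at *
  rw [h3] at hα hαβ
  rw [h4] at hβ hαβ
  obtain ⟨δ, hδ⟩ : ∃ δ, δ = α 0 * β 1 - α 1 * β 0 := ⟨_, rfl⟩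
  have hδ2 : δ ^ 2 = (a * b) ^ 2 := by
    rw [hδ, mul_pow, ← hα, ← hβ]
    linear_combination (-(α 0 * β 0 + α 1 * β 1)) * hαβ
  have hk : K (ω, α, β) = a ^ 2 + b ^ 2 - 2 * δ := by
    simp only [K, h1, h2]
    linear_combination hα + hβ + 2 * hδ
  have hg : G a b (ω, α, β) = δ * H (ω, α, β) := by
    rw [G_eq, ← hα, ← hβ, hδ]
    simp only [H, h1, h2, h3, h4]
    linear_combination (-(α 1 + β 0)) * hαβ
  have hy : (α 0 + β 1) ^ 2 ≤ a ^ 2 + b ^ 2 + 2 * δ := by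
    nlinarith [sq_nonneg (α 1 - β 0)]
  have hle : -(α 0 + β 1) ≤ H (ω, α, β) := by
    simp only [H, h1, h2]
    linarith [sq_nonneg (ω 2)]
  simp only [J, sheet4Param, Prod.mk.injEq] at hJ
  obtain ⟨e1, e2, e3⟩ := hJ
  rw [hg, e1] at e3
  rw [hk] at e2
  rw [e1] at hH hle
  have f1 : (s ^ 2 - δ) * (s * h - s ^ 2 - δ) = 0 := by
    field_simp at e3
    linear_combination -e3 + hδ2
  have f2 : s * h = s ^ 2 + δ := by
    rcases mul_eq_zero.1 f1 with f | f
    · have hc : (a * b) ^ 2 = s ^ 2 * s ^ 2 := by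
        rw [← hδ2]; linear_combination (-(δ + s ^ 2)) * f
      rw [hc] at e2
      have f3 : (h - 2 * s) ^ 2 = 0 := by
        field_simp at e2
        linear_combination -e2 + 2 * f
      have f4 : h = 2 * s := by linarith [pow_eq_zero_iff (two_ne_zero) |>.1 f3]
      rw [f4]; linear_combination f
    · linarith
  rcases sq_eq_sq_iff_eq_or_eq_neg.1 hδ2 with hd | hd
  · rw [hd] at f2
    rcases hs.lt_or_gt with h0 | h0
    · have f3 : (s + a) * (s + b) ≤ 0 := by
        nlinarith [mul_le_mul_of_nonpos_left hH h0.le]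
      refine Or.inl ⟨?_, ?_, le_of_eq ?_⟩
      · by_contra! hcon
        nlinarith
      · by_contra! hcon
        nlinarith
      · field_simp
        linarith
    · exact admissible_of_pos_of_eq_add hb hab h0 f2
  · rw [hd] at f2 hy
    have hle' : -(a - b) ≤ h := by
      have := abs_le_of_sq_le_sq' (by linarith : (α 0 + β 1) ^ 2 ≤ (a - b) ^ 2) (by linarith)
      linarith [this.2]
    refine admissible_of_eq_sub hb hab ?_ (by linarith)
    rcases hs.lt_or_gt with h0 | h0
    · right
      exact ⟨(mem_of_mul_nonpos (p := -a) (q := b) (by linarith)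
        (by linarith [mul_le_mul_of_nonpos_left hle' h0.le])).1, h0⟩
    · left
      have f3 : 0 ≤ (s + a) * (s - b) := by
        linarith [mul_le_mul_of_nonneg_left hle' h0.le]
      linarith [nonneg_of_mul_nonneg_right f3 (by linarith)]

/-- The parameters of a critical value on the sheet are admissible. -/
theorem admissible_of_critical {a b s h : ℝ} (hb : 0 < b) (hab : b < a) {x : Ambient}
    (hx : x ∈ criticalSet a b) (hs : s ≠ 0) (hJ : J a b x = sheet4Param a b s h) :
    Admissible a b s h := by
  rcases critical_classification hb hab hx with h1 | h1 | ⟨s', h1⟩ | h1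
  · exact admissible_of_K_eq_zero hb hab hx.1 h1 hs hJ
  · exact h1.admissible hb hab hx.1 hs hJ
  · obtain ⟨hs', hJ'⟩ := h1.J_eq hb hab hx.1
    have hH : H x = h := congrArg Prod.fst hJ
    have hadm := h1.admissible hb hab hx.1
    rw [hH] at hJ' hadm
    exact hadm.congr_param hb hab hs hs' (hJ.symm.trans hJ')
  · exact h1.admissible hb hab hx.1 hs hJ

/-! ### Admissible parameters give critical values -/

/-- At a point over the sheet the combination `s (s - h) dH + (s / 2) dK + dG` vanishes on the
tangent space; the Lagrange multipliers are `|β + s e₂|² / s`, `|α + s e₁|² / s` and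
`-(α₂ + β₁)`. -/
theorem IsSheetFourPoint.mem_criticalSet {a b s : ℝ} (hb : 0 < b) (hab : b < a) {x : Ambient}
    (hx : x ∈ P6 a b) (h : IsSheetFourPoint s x) : x ∈ criticalSet a b := by
  have hs := (h.J_eq hb hab hx).1
  refine ⟨hx, (rankJ_lt_three_iff a b x).2 ⟨s * (s - H x), s / 2, 1, by simp, ?_⟩⟩
  intro v hv
  obtain ⟨hα, hβ, hαβ⟩ := mem_P6_iff.1 hx
  obtain ⟨t1, t2, t3⟩ := mem_tangent.1 hv
  obtain ⟨ω, α, β⟩ := x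
  obtain ⟨o, p, q⟩ := v
  obtain ⟨h1, h2, h3, h4, h5⟩ := h
  simp only [dH, dK, dG, H] at *
  rw [← hα, ← hβ]
  apply mul_left_cancel₀ hs
  linear_combination
    s * o 0 * (2 * (α 0 + s) * h1 + 2 * β 0 * h2 - ω 2 * h3)
    + s * o 1 * (2 * α 1 * h1 + 2 * (β 1 + s) * h2 - ω 2 * h4)
    + s * o 2 * (α 2 * h1 + β 2 * h2 - ω 0 * h3 - ω 1 * h4 - ω 2 * h5)
    + 2 * s * (p 0 * ω 0 + p 1 * ω 1 + p 2 * ω 2 / 2) * h1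
    + 2 * s * (q 0 * ω 0 + q 1 * ω 1 + q 2 * ω 2 / 2) * h2
    + (p 1 * β 2 - p 2 * β 1 + (α 1 * q 2 - α 2 * q 1)) * h3
    + (p 2 * β 0 - p 0 * β 2 + (α 2 * q 0 - α 0 * q 2)) * h4
    + (p 0 * β 1 - p 1 * β 0 + (α 0 * q 1 - α 1 * q 0)) * h5
    + s * (h5 * p 0 - h3 * p 2) + s * (h5 * q 1 - h4 * q 2)
    - (p 0 * β 0 + p 1 * (β 1 + s) + p 2 * β 2) * hαβ
    - (q 0 * (α 0 + s) + q 1 * α 1 + q 2 * α 2) * hαβ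
    + (β 0 ^ 2 + (β 1 + s) ^ 2 + β 2 ^ 2) * t1 + ((α 0 + s) ^ 2 + α 1 ^ 2 + α 2 ^ 2) * t2
    - s * (α 1 + β 0) * t3

theorem IsSheetFourPoint.mem_bifDiagram {a b s h : ℝ} (hb : 0 < b) (hab : b < a) {x : Ambient}
    (hx : x ∈ P6 a b) (hp : IsSheetFourPoint s x) (hH : H x = h) :
    sheet4Param a b s h ∈ bifDiagram a b :=
  ⟨x, hp.mem_criticalSet hb hab hx, hH ▸ (hp.J_eq hb hab hx).2⟩

/-- The points over the sheet with `β = (0, e, 0)` and `ω₂ = 0`, where `ω₃² = 2 (s + e)² y`. The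
parameter `y` is a root of `s² (b² - s²) y² - 2 s² (h - 2 s) y + a² - s² = 0`; this equation is
written with the two factors `c`, `c'` of `s⁻² (a² - s²) (b² - s²)` whose sum is `2 (h - 2 s)`. -/
theorem sheet4Param_mem_bifDiagram_of_root {a b s h e y c c' : ℝ} (hb : 0 < b) (hab : b < a)
    (hs : s ≠ 0) (he : e ^ 2 = b ^ 2) (hse : s + e ≠ 0) (hy : 0 < y)
    (hc : y * s ^ 2 * c = a ^ 2 - s ^ 2) (hc' : y * (b ^ 2 - s ^ 2) = c')
    (ht : c + c' = 2 * (h - 2 * s)) (hl : s - a ≤ (s + e) * s * y) (hu : (s + e) * s * y ≤ s + a) :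
    sheet4Param a b s h ∈ bifDiagram a b := by
  obtain ⟨p, hp⟩ : ∃ p, p = (s + e) * s * y - s := ⟨_, rfl⟩
  have hpa : p ^ 2 ≤ a ^ 2 := sq_le_sq' (by linarith) (by linarith)
  obtain ⟨q, hq⟩ : ∃ q, q = √(a ^ 2 - p ^ 2) := ⟨_, rfl⟩
  have hq2 : q ^ 2 = a ^ 2 - p ^ 2 := by rw [hq, Real.sq_sqrt (by linarith)]
  have hpos : 0 < 2 * (s + e) ^ 2 * y := by positivity
  obtain ⟨v, hv⟩ : ∃ v, v = √(2 * (s + e) ^ 2 * y) := ⟨_, rfl⟩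
  have hv2 : v ^ 2 = 2 * (s + e) ^ 2 * y := by rw [hv, Real.sq_sqrt hpos.le]
  have hv0 : v ≠ 0 := by rw [hv]; exact (Real.sqrt_pos.2 hpos).ne'
  obtain ⟨w, hw⟩ : ∃ w, w * (s * v) = -q * (s + e) :=
    ⟨-q * (s + e) / (s * v), by field_simp⟩
  have hsv : s * v ≠ 0 := mul_ne_zero hs hv0
  refine IsSheetFourPoint.mem_bifDiagram (x := (![w, 0, v], ![p, 0, q], ![0, e, 0])) hb hab
    ?_ ?_ ?_
  · rw [mem_P6_iff]
    simp [hq2, he]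
  · simp only [IsSheetFourPoint, Matrix.cons_val_zero, Matrix.cons_val_one, Matrix.cons_val]
    refine ⟨?_, by ring, ?_, by ring, ?_⟩
    · apply mul_left_cancel₀ hsv
      rw [hp]
      linear_combination (s + e) * s * y * hw + q * s / 2 * hv2
    · linear_combination hw
    · rw [hp]
      linear_combination s / 2 * hv2
  · simp only [H, Matrix.cons_val_zero, Matrix.cons_val_one, Matrix.cons_val]
    have hw2 : w ^ 2 * (2 * s ^ 2 * y) = a ^ 2 - p ^ 2 := by
      apply mul_left_cancel₀ (pow_ne_zero 2 hse)
      rw [← hq2]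
      linear_combination (w * (s * v) - q * (s + e)) * hw - w ^ 2 * s ^ 2 * hv2
    have h0 : 2 * s ^ 2 * y ≠ 0 := by positivity
    apply mul_left_cancel₀ h0
    rw [hp] at hw2 ⊢
    linear_combination hw2 + s ^ 2 * y * hv2 + s ^ 2 * y * ht - hc + s ^ 2 * y * hc'
      + s ^ 2 * y ^ 2 * he

/-- For `s = ±a` the frame with `α = -s e₁` admits arbitrary `ω₁`. -/
theorem sheet4Param_mem_bifDiagram_of_sq_eq_a {a b s h : ℝ} (hb : 0 < b) (hab : b < a)
    (hs : s ^ 2 = a ^ 2) (hh : s - b ≤ h) : sheet4Param a b s h ∈ bifDiagram a b := by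
  refine IsSheetFourPoint.mem_bifDiagram (s := s)
    (x := (![√(h - (s - b)), 0, 0], ![-s, 0, 0], ![0, b, 0])) hb hab ?_ ?_ ?_
  · rw [mem_P6_iff]
    simp [hs]
  · simp only [IsSheetFourPoint, Matrix.cons_val_zero, Matrix.cons_val_one, Matrix.cons_val]
    refine ⟨by ring, by ring, by ring, by ring, by ring⟩
  · simp only [H, Matrix.cons_val_zero, Matrix.cons_val_one, Matrix.cons_val]
    rw [Real.sq_sqrt (by linarith)]
    ring

/-- For `s = ±b` the frame with `β = -s e₂` admits arbitrary `ω₂`. -/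
theorem sheet4Param_mem_bifDiagram_of_sq_eq_b {a b s h : ℝ} (hb : 0 < b) (hab : b < a)
    (hs : s ^ 2 = b ^ 2) (hh : s - a ≤ h) : sheet4Param a b s h ∈ bifDiagram a b := by
  refine IsSheetFourPoint.mem_bifDiagram (s := s)
    (x := (![0, √(h - (s - a)), 0], ![a, 0, 0], ![0, -s, 0])) hb hab ?_ ?_ ?_
  · rw [mem_P6_iff]
    simp [hs]
  · simp only [IsSheetFourPoint, Matrix.cons_val_zero, Matrix.cons_val_one, Matrix.cons_val]
    refine ⟨by ring, by ring, by ring, by ring, by ring⟩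
  · simp only [H, Matrix.cons_val_zero, Matrix.cons_val_one, Matrix.cons_val]
    rw [Real.sq_sqrt (by linarith)]
    ring

theorem sq_phi {a b s : ℝ} (hs : s ≠ 0) (h : 0 ≤ (s ^ 2 - a ^ 2) * (s ^ 2 - b ^ 2)) :
    s ^ 2 * phi a b s ^ 2 = (s ^ 2 - a ^ 2) * (s ^ 2 - b ^ 2) := by
  rw [phi, Real.sq_sqrt (by positivity)]
  field_simp

/-- The case `|s| < b`; the smaller root `y` is taken. -/
theorem sheet4Param_mem_bifDiagram_of_sq_lt {a b s h : ℝ} (hb : 0 < b) (hab : b < a) (hs : s ≠ 0)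
    (hsb : s ^ 2 < b ^ 2) (hh : hPlus a b s ≤ h) : sheet4Param a b s h ∈ bifDiagram a b := by
  have ha : 0 < a := hb.trans hab
  have hba : b ^ 2 < a ^ 2 := by nlinarith
  obtain ⟨l1, l2⟩ := abs_lt_of_sq_lt_sq' hsb hb.le
  have hD : 0 < (s ^ 2 - a ^ 2) * (s ^ 2 - b ^ 2) :=
    mul_pos_of_neg_of_neg (by linarith) (by linarith)
  have hφ := sq_phi hs hD.le
  have hφ0 := phi_nonneg a b s
  rw [hPlus] at hh
  obtain ⟨t, ht⟩ : ∃ t, t = h - 2 * s := ⟨_, rfl⟩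
  have htφ : phi a b s ≤ t := by linarith
  have ht0 : 0 < t := by
    rcases hφ0.eq_or_lt with h0 | h0
    · rw [← h0] at hφ
      simp only [ne_eq, OfNat.ofNat_ne_zero, not_false_eq_true, zero_pow, mul_zero] at hφ
      linarith
    · linarith
  have hkt : phi a b s ^ 2 ≤ t ^ 2 := pow_le_pow_left₀ hφ0 htφ 2
  obtain ⟨κ, hκ⟩ : ∃ κ, κ = √(t ^ 2 - phi a b s ^ 2) := ⟨_, rfl⟩
  have hκ0 : 0 ≤ κ := hκ ▸ Real.sqrt_nonneg _
  have hκ2 : κ ^ 2 = t ^ 2 - phi a b s ^ 2 := by rw [hκ, Real.sq_sqrt (by linarith)]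
  clear hκ
  have hc : 0 < t + κ := by linarith
  have hy : 0 < (a ^ 2 - s ^ 2) / (s ^ 2 * (t + κ)) := by
    have : 0 < a ^ 2 - s ^ 2 := by linarith
    positivity
  have hX : (s ^ 2 - a ^ 2) * (s ^ 2 - b ^ 2) ≤ (s * (t + κ)) ^ 2 := by
    rw [← hφ, mul_pow]
    exact mul_le_mul_of_nonneg_left (by nlinarith) (sq_nonneg s)
  obtain ⟨y, hye⟩ : ∃ y, y = (a ^ 2 - s ^ 2) / (s ^ 2 * (t + κ)) := ⟨_, rfl⟩
  rw [← hye] at hy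
  have e1 : y * s ^ 2 * (t + κ) = a ^ 2 - s ^ 2 := by rw [hye]; field_simp
  have e2 : y * (b ^ 2 - s ^ 2) = t - κ := by
    rw [hye]
    field_simp
    linear_combination -hφ + s ^ 2 * hκ2
  have e3 : t + κ + (t - κ) = 2 * (h - 2 * s) := by rw [ht]; ring
  have e4 : s * y * (s * (t + κ)) = (a - s) * (a + s) := by linear_combination e1
  -- the sign of `e = ±b` is chosen so that `(s + e) s y < 0`, which settles one of the two bounds
  rcases hs.lt_or_gt with h0 | h0
  · have hX1 : (b + s) * (a + s) ≤ -(s * (t + κ)) := by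
      refine abs_le_of_sq_le_sq (le_trans ?_ (hX.trans_eq (neg_sq _).symm))
        (by nlinarith) |> (le_abs_self _).trans
      nlinarith [mul_pos (by linarith : 0 < b + s) (by linarith : 0 < a + s),
        mul_neg_of_pos_of_neg (by linarith : 0 < a + b) h0]
    refine sheet4Param_mem_bifDiagram_of_root (e := b) hb hab hs rfl (by linarith) hy e1 e2 e3
      ?_ ?_
    · have : 0 < -(s * (t + κ)) := by nlinarith
      rw [← sub_nonneg]
      refine nonneg_of_mul_nonneg_left ?_ this
      have e5 : ((b + s) * (a + s)) * (a - s) ≤ -(s * (t + κ)) * (a - s) :=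
        mul_le_mul_of_nonneg_right hX1 (by linarith)
      linear_combination e5 + (s + b) * e4
    · have : (s + b) * s * y < 0 :=
        mul_neg_of_neg_of_pos (mul_neg_of_pos_of_neg (by linarith) h0) hy
      linarith
  · have hX1 : (b - s) * (a + s) ≤ s * (t + κ) := by
      refine abs_le_of_sq_le_sq (le_trans ?_ hX) (by positivity) |> (le_abs_self _).trans
      nlinarith [mul_pos (by linarith : 0 < b - s) (by linarith : 0 < a + s),
        mul_pos (by linarith : 0 < a - b) h0]
    refine sheet4Param_mem_bifDiagram_of_root (e := -b) hb hab hs (neg_sq b) (by linarith) hy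
      e1 e2 e3 ?_ ?_
    · have : 0 < s * (t + κ) := by positivity
      rw [← sub_nonneg]
      refine nonneg_of_mul_nonneg_left ?_ this
      have e5 : ((b - s) * (a + s)) * (a - s) ≤ (s * (t + κ)) * (a - s) :=
        mul_le_mul_of_nonneg_right hX1 (by linarith)
      linear_combination e5 + (b - s) * e4
    · have : (s + -b) * s * y < 0 :=
        mul_neg_of_neg_of_pos (mul_neg_of_neg_of_pos (by linarith) h0) hy
      linarith

/-- Comparison of two pairs with the same product and ordered sums. -/
theorem le_of_mul_eq_mul_of_add_le {X X' Y Y' : ℝ} (hX : 0 < X) (hmul : X * X' = Y * Y')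
    (hadd : Y + Y' ≤ X + X') (hYY : Y' ≤ 0) : Y ≤ X := by
  by_contra! hcon
  have h1 : 0 < (Y - X) * (X - Y') := mul_pos (by linarith) (by linarith)
  nlinarith [mul_le_mul_of_nonneg_left hadd hX.le]

/-- The case `b < |s| < a`; the roots `y` have opposite signs, and the positive one is taken. -/
theorem sheet4Param_mem_bifDiagram_of_lt_sq_of_sq_lt {a b s h : ℝ} (hb : 0 < b) (hab : b < a)
    (hsb : b ^ 2 < s ^ 2) (hsa : s ^ 2 < a ^ 2) (hp : 0 < s → s ^ 2 - a * b ≤ s * h)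
    (hn : s < 0 → s * h ≤ s ^ 2 + a * b) : sheet4Param a b s h ∈ bifDiagram a b := by
  have ha : 0 < a := hb.trans hab
  have hs : s ≠ 0 := by rintro rfl; nlinarith
  obtain ⟨l1, l2⟩ := abs_lt_of_sq_lt_sq' hsa ha.le
  have hD : 0 < (a ^ 2 - s ^ 2) * (s ^ 2 - b ^ 2) := mul_pos (by linarith) (by linarith)
  obtain ⟨t, ht⟩ : ∃ t, t = h - 2 * s := ⟨_, rfl⟩
  obtain ⟨d, hd⟩ : ∃ d, d = (a ^ 2 - s ^ 2) * (s ^ 2 - b ^ 2) / s ^ 2 := ⟨_, rfl⟩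
  have hd0 : 0 < d := by rw [hd]; positivity
  have hd1 : s ^ 2 * d = (a ^ 2 - s ^ 2) * (s ^ 2 - b ^ 2) := by rw [hd]; field_simp
  obtain ⟨κ, hκ⟩ : ∃ κ, κ = √(t ^ 2 + d) := ⟨_, rfl⟩
  have hκ2 : κ ^ 2 = t ^ 2 + d := by rw [hκ, Real.sq_sqrt (by positivity)]
  have hκt : |t| < κ := by
    rw [hκ]
    exact Real.lt_sqrt_of_sq_lt (by rw [sq_abs]; linarith)
  clear hκ hd
  have hc : 0 < t + κ := by linarith [neg_abs_le t]
  have hy : 0 < (a ^ 2 - s ^ 2) / (s ^ 2 * (t + κ)) := by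
    have : 0 < a ^ 2 - s ^ 2 := by linarith
    positivity
  obtain ⟨y, hye⟩ : ∃ y, y = (a ^ 2 - s ^ 2) / (s ^ 2 * (t + κ)) := ⟨_, rfl⟩
  rw [← hye] at hy
  have e1 : y * s ^ 2 * (t + κ) = a ^ 2 - s ^ 2 := by rw [hye]; field_simp
  have e2 : y * (b ^ 2 - s ^ 2) = t - κ := by
    rw [hye]
    field_simp
    linear_combination hd1 + s ^ 2 * hκ2
  have e3 : t + κ + (t - κ) = 2 * (h - 2 * s) := by rw [ht]; ring
  have e4 : s * y * (s * (t + κ)) = (a - s) * (a + s) := by linear_combination e1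
  rcases hs.lt_or_gt with h0 | h0
  · have hsb' : s < -b := by nlinarith
    have hXp : 0 < -s * (t + κ) := by nlinarith
    have hX1 : (-s - b) * (a - s) ≤ -s * (t + κ) := by
      refine le_of_mul_eq_mul_of_add_le (X' := -s * (t - κ)) (Y' := -(-s + b) * (a + s)) hXp
        ?_ ?_ ?_
      · linear_combination -hd1 - s ^ 2 * hκ2
      · rw [ht]; nlinarith [hn h0]
      · nlinarith [mul_pos (by linarith : 0 < -s + b) (by linarith : 0 < a + s)]
    refine sheet4Param_mem_bifDiagram_of_root (e := b) hb hab hs rfl (by linarith) hy e1 e2 e3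
      ?_ ?_
    · have : 0 < (s + b) * s * y := mul_pos (mul_pos_of_neg_of_neg (by linarith) h0) hy
      linarith
    · rw [← sub_nonneg]
      refine nonneg_of_mul_nonneg_left ?_ hXp
      have e5 := mul_le_mul_of_nonneg_right hX1 (by linarith : 0 ≤ a + s)
      linear_combination e5 - (s + b) * e4
  · have hsb' : b < s := by nlinarith
    have hXp : 0 < s * (t + κ) := by positivity
    have hX1 : (s - b) * (a - s) ≤ s * (t + κ) := by
      refine le_of_mul_eq_mul_of_add_le (X' := s * (t - κ)) (Y' := -(s + b) * (a + s)) hXp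
        ?_ ?_ ?_
      · linear_combination -hd1 - s ^ 2 * hκ2
      · rw [ht]; nlinarith [hp h0]
      · nlinarith [mul_pos (by linarith : 0 < s + b) (by linarith : 0 < a + s)]
    refine sheet4Param_mem_bifDiagram_of_root (e := -b) hb hab hs (neg_sq b) (by linarith) hy
      e1 e2 e3 ?_ ?_
    · have : 0 < (s + -b) * s * y := mul_pos (mul_pos (by linarith) h0) hy
      linarith
    · rw [← sub_nonneg]
      refine nonneg_of_mul_nonneg_left ?_ hXp
      have e5 := mul_le_mul_of_nonneg_right hX1 (by linarith : 0 ≤ a + s)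
      linear_combination e5 + (s - b) * e4

/-- The case `s > a`; the larger root `y` is taken. -/
theorem sheet4Param_mem_bifDiagram_of_lt {a b s h : ℝ} (hb : 0 < b) (hab : b < a)
    (hsa : a < s) (hl : s ^ 2 - a * b ≤ s * h) (hh : h ≤ hMinus a b s) :
    sheet4Param a b s h ∈ bifDiagram a b := by
  have ha : 0 < a := hb.trans hab
  have h0 : 0 < s := ha.trans hsa
  have hs : s ≠ 0 := h0.ne'
  have hba : b ^ 2 < a ^ 2 := by nlinarith
  have has : a ^ 2 < s ^ 2 := by nlinarith
  have hD : 0 < (s ^ 2 - a ^ 2) * (s ^ 2 - b ^ 2) := mul_pos (by linarith) (by linarith)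
  have hφ := sq_phi hs hD.le
  have hφ0 := phi_nonneg a b s
  have hφ1 : 0 < phi a b s := by
    rcases hφ0.eq_or_lt with h1 | h1
    · rw [← h1] at hφ
      simp only [ne_eq, OfNat.ofNat_ne_zero, not_false_eq_true, zero_pow, mul_zero] at hφ
      linarith
    · exact h1
  rw [hMinus] at hh
  -- `t = 2 s - h` is positive here
  obtain ⟨t, ht⟩ : ∃ t, t = 2 * s - h := ⟨_, rfl⟩
  have htφ : phi a b s ≤ t := by linarith
  have ht0 : 0 < t := by linarith
  have hkt : phi a b s ^ 2 ≤ t ^ 2 := pow_le_pow_left₀ hφ0 htφ 2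
  obtain ⟨κ, hκ⟩ : ∃ κ, κ = √(t ^ 2 - phi a b s ^ 2) := ⟨_, rfl⟩
  have hκ0 : 0 ≤ κ := hκ ▸ Real.sqrt_nonneg _
  have hκ2 : κ ^ 2 = t ^ 2 - phi a b s ^ 2 := by rw [hκ, Real.sq_sqrt (by linarith)]
  clear hκ
  have hκt : κ < t := by
    refine lt_of_pow_lt_pow_left₀ 2 ht0.le ?_
    have := pow_pos hφ1 2
    linarith
  have hc : 0 < t - κ := by linarith
  have hy : 0 < (s ^ 2 - a ^ 2) / (s ^ 2 * (t - κ)) := by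
    have : 0 < s ^ 2 - a ^ 2 := by linarith
    positivity
  obtain ⟨y, hye⟩ : ∃ y, y = (s ^ 2 - a ^ 2) / (s ^ 2 * (t - κ)) := ⟨_, rfl⟩
  rw [← hye] at hy
  have e1 : y * s ^ 2 * (t - κ) = s ^ 2 - a ^ 2 := by rw [hye]; field_simp
  have e2 : y * (b ^ 2 - s ^ 2) = -(t + κ) := by
    rw [hye]
    field_simp
    linear_combination hφ - s ^ 2 * hκ2
  have e3 : -(t - κ) + -(t + κ) = 2 * (h - 2 * s) := by rw [ht]; ring
  have e4 : s * y * (s * (t - κ)) = (s - a) * (a + s) := by linear_combination e1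
  have hXp : 0 < s * (t - κ) := by positivity
  have hXX : s * (t - κ) * (s * (t + κ)) = (s ^ 2 - a ^ 2) * (s ^ 2 - b ^ 2) := by
    linear_combination hφ - s ^ 2 * hκ2
  have hX1 : s * (t - κ) ≤ (s - b) * (s + a) := by
    have h1 : 0 < (s - b) * (s + a) := mul_pos (by linarith) (by linarith)
    refine (le_abs_self _).trans (abs_le_of_sq_le_sq ?_ h1.le)
    calc (s * (t - κ)) ^ 2 = s * (t - κ) * (s * (t - κ)) := sq _
      _ ≤ s * (t - κ) * (s * (t + κ)) :=
        mul_le_mul_of_nonneg_left (mul_le_mul_of_nonneg_left (by linarith) h0.le) hXp.le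
      _ = ((s - a) * (s + b)) * ((s - b) * (s + a)) := by rw [hXX]; ring
      _ ≤ ((s - b) * (s + a)) * ((s - b) * (s + a)) :=
        mul_le_mul_of_nonneg_right (by nlinarith) h1.le
      _ = _ := (sq _).symm
  have hX2 : (s - b) * (s - a) ≤ s * (t - κ) := by
    by_contra! hcon
    have h1 : s * (t - κ) < (s + a) * (s + b) := by nlinarith
    have h2 := mul_pos (sub_pos.2 hcon) (sub_pos.2 h1)
    have h3 : s * (t - κ) + s * (t + κ) ≤ (s - b) * (s - a) + (s + a) * (s + b) := by
      rw [ht]; nlinarith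
    nlinarith [mul_le_mul_of_nonneg_left h3 hXp.le]
  refine sheet4Param_mem_bifDiagram_of_root (e := -b) (c := -(t - κ)) hb hab hs (neg_sq b)
    (by linarith) hy (by linear_combination -e1) e2 e3 ?_ ?_
  · rw [← sub_nonneg]
    refine nonneg_of_mul_nonneg_left ?_ hXp
    have e5 := mul_le_mul_of_nonneg_right hX1 (by linarith : 0 ≤ s - a)
    linear_combination e5 + (b - s) * e4
  · rw [← sub_nonneg]
    refine nonneg_of_mul_nonneg_left ?_ hXp
    have e5 := mul_le_mul_of_nonneg_right hX2 (by linarith : 0 ≤ a + s)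
    linear_combination e5 + (s - b) * e4

theorem Admissible.mem_bifDiagram {a b s h : ℝ} (hb : 0 < b) (hab : b < a)
    (hadm : Admissible a b s h) : sheet4Param a b s h ∈ bifDiagram a b := by
  have ha : 0 < a := hb.trans hab
  have hpos : ∀ _ : 0 < s, s - a * b / s ≤ h → s ^ 2 - a * b ≤ s * h := by
    intro h0 h1
    have := mul_le_mul_of_nonneg_left h1 h0.le
    have e : s * (s - a * b / s) = s ^ 2 - a * b := by field_simp
    linarith
  rcases hadm with ⟨h1, h2, h3⟩ | ⟨h0, h1, h2, h3⟩ | ⟨h1, h2, h3⟩ | ⟨h1, h2, h3⟩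
  · rcases h1.eq_or_lt with rfl | h1'
    · refine sheet4Param_mem_bifDiagram_of_sq_eq_a hb hab (neg_sq a) ?_
      rwa [div_neg, mul_div_cancel_left₀ _ ha.ne'] at h3
    rcases h2.eq_or_lt with rfl | h2'
    · refine sheet4Param_mem_bifDiagram_of_sq_eq_b hb hab (neg_sq b) ?_
      rwa [div_neg, mul_div_cancel_right₀ _ hb.ne'] at h3
    have h0 : s < 0 := by linarith
    refine sheet4Param_mem_bifDiagram_of_lt_sq_of_sq_lt hb hab (by nlinarith) (by nlinarith)
      (fun h => by linarith) (fun _ => ?_)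
    have := mul_le_mul_of_nonpos_left h3 h0.le
    have hne : s ≠ 0 := h0.ne
    have e : s * (s + a * b / s) = s ^ 2 + a * b := by field_simp
    linarith
  · have hφ := phi_nonneg a b s
    have h4 : 2 * s ≤ h := by rw [hPlus] at h3; linarith
    rcases (sq_le_sq' h1 h2).eq_or_lt with h5 | h5
    · exact sheet4Param_mem_bifDiagram_of_sq_eq_b hb hab h5 (by linarith)
    · exact sheet4Param_mem_bifDiagram_of_sq_lt hb hab h0 h5 h3
  · rcases h2.eq_or_lt with rfl | h2'
    · refine sheet4Param_mem_bifDiagram_of_sq_eq_a hb hab rfl ?_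
      rwa [mul_div_cancel_left₀ _ ha.ne'] at h3
    rcases h1.eq_or_lt with rfl | h1'
    · refine sheet4Param_mem_bifDiagram_of_sq_eq_b hb hab rfl ?_
      rwa [mul_div_cancel_right₀ _ hb.ne'] at h3
    have h0 : 0 < s := by linarith
    exact sheet4Param_mem_bifDiagram_of_lt_sq_of_sq_lt hb hab (by nlinarith) (by nlinarith)
      (fun _ => hpos h0 h3) (fun h => by linarith)
  · rcases h1.eq_or_lt with rfl | h1'
    · refine sheet4Param_mem_bifDiagram_of_sq_eq_a hb hab rfl ?_
      rwa [mul_div_cancel_left₀ _ ha.ne'] at h2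
    · exact sheet4Param_mem_bifDiagram_of_lt hb hab h1' (hpos (by linarith) h2) h3

open Set

/-! ### Monotonicity of `2 s ± φ(s)` -/

theorem sq_sub_mul_sq_sub_nonneg {a b s : ℝ} (hb : 0 < b) (hab : b < a) (hsb : s ^ 2 ≤ b ^ 2) :
    0 ≤ (s ^ 2 - a ^ 2) * (s ^ 2 - b ^ 2) :=
  mul_nonneg_of_nonpos_of_nonpos (by nlinarith) (by linarith)

theorem phi_eq_zero_of_sq_eq_a {a b s : ℝ} (h : s ^ 2 = a ^ 2) : phi a b s = 0 := by
  simp [phi, h]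

theorem phi_eq_zero_of_sq_eq_b {a b s : ℝ} (h : s ^ 2 = b ^ 2) : phi a b s = 0 := by
  simp [phi, h]

theorem phi_neg (a b s : ℝ) : phi a b (-s) = phi a b s := by
  simp [phi]

theorem continuousOn_phi (a b : ℝ) : ContinuousOn (phi a b) {0}ᶜ := by
  unfold phi
  refine (ContinuousOn.div (by fun_prop) (by fun_prop) ?_).sqrt
  intro s hs
  exact pow_ne_zero 2 hs

theorem continuousOn_hPlus (a b : ℝ) : ContinuousOn (hPlus a b) {0}ᶜ :=
  (by fun_prop : ContinuousOn (fun s : ℝ => 2 * s) {0}ᶜ).add (continuousOn_phi a b)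

theorem continuousOn_hMinus (a b : ℝ) : ContinuousOn (hMinus a b) {0}ᶜ :=
  (by fun_prop : ContinuousOn (fun s : ℝ => 2 * s) {0}ᶜ).sub (continuousOn_phi a b)

/-- `φ` is a strictly decreasing function of `|s|` for `0 < |s| ≤ b`. -/
theorem phi_lt_phi {a b s t : ℝ} (hb : 0 < b) (hab : b < a) (ht : t ≠ 0)
    (hts : t ^ 2 < s ^ 2) (hsb : s ^ 2 ≤ b ^ 2) : phi a b s < phi a b t := by
  have ht2 : 0 < t ^ 2 := by positivity
  have hs2 : 0 < s ^ 2 := ht2.trans hts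
  have hba : b ^ 2 < a ^ 2 := by nlinarith
  refine Real.sqrt_lt_sqrt (div_nonneg (sq_sub_mul_sq_sub_nonneg hb hab hsb) hs2.le) ?_
  rw [div_lt_div_iff₀ hs2 ht2]
  have h1 : (s ^ 2 - a ^ 2) * (s ^ 2 - b ^ 2) ≤ (t ^ 2 - a ^ 2) * (t ^ 2 - b ^ 2) := by
    nlinarith
  have h2 : 0 < (t ^ 2 - a ^ 2) * (t ^ 2 - b ^ 2) :=
    mul_pos_of_neg_of_neg (by linarith) (by linarith)
  exact (mul_le_mul_of_nonneg_right h1 ht2.le).trans_lt (mul_lt_mul_of_pos_left hts h2)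

theorem strictMonoOn_hPlus {a b : ℝ} (hb : 0 < b) (hab : b < a) :
    StrictMonoOn (hPlus a b) (Ico (-b) 0) := by
  intro s hs t ht hst
  have := phi_lt_phi hb hab ht.2.ne (by nlinarith [ht.2] : t ^ 2 < s ^ 2)
    (sq_le_sq' hs.1 (hs.2.le.trans hb.le))
  unfold hPlus
  linarith

/-- The polynomial `S³ ((s - a² b² / s³)² - 4 φ(s)²)` in `S = s²`: its sign decides the sign of the
derivative of `2 s ± φ(s)`. -/
def slopeQuartic (a b S : ℝ) : ℝ :=
  (a * b) ^ 4 - 6 * (a * b) ^ 2 * S ^ 2 + 4 * (a ^ 2 + b ^ 2) * S ^ 3 - 3 * S ^ 4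

theorem slopeQuartic_pos {a b S : ℝ} (hb : 0 < b) (hab : b < a) (h0 : 0 < S) (hS : S ≤ b ^ 2) :
    0 < slopeQuartic a b S := by
  have hba : 0 < a ^ 2 - b ^ 2 := by nlinarith
  have e : slopeQuartic a b S = b ^ 4 * (a ^ 2 - b ^ 2) ^ 2
      + (b ^ 2 - S) ^ 2 * (3 * S * (b ^ 2 - S) + 4 * (a ^ 2 - b ^ 2) * S
        + b ^ 2 * (2 * (a ^ 2 - b ^ 2) + (b ^ 2 - S))) := by
    unfold slopeQuartic; ring
  have h1 : 0 ≤ b ^ 2 - S := by linarith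
  rw [e]
  positivity

theorem slopeQuartic_pos_sq_a {a b : ℝ} (hb : 0 < b) (hab : b < a) :
    0 < slopeQuartic a b (a ^ 2) := by
  have hba : 0 < a ^ 2 - b ^ 2 := by nlinarith
  have ha : 0 < a := hb.trans hab
  have e : slopeQuartic a b (a ^ 2) = a ^ 4 * (a ^ 2 - b ^ 2) ^ 2 := by
    unfold slopeQuartic; ring
  rw [e]
  positivity

theorem strictAntiOn_slopeQuartic {a b : ℝ} (hb : 0 < b) (hab : b < a) :
    StrictAntiOn (slopeQuartic a b) (Ici (a ^ 2)) := by
  refine strictAntiOn_of_deriv_neg (convex_Ici _)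
    (by unfold slopeQuartic; fun_prop) ?_
  intro S hS
  rw [interior_Ici, mem_Ioi] at hS
  have hba : b ^ 2 < a ^ 2 := by nlinarith
  have hd : HasDerivAt (slopeQuartic a b) (-12 * (S * (S - a ^ 2) * (S - b ^ 2))) S := by
    have h := (((hasDerivAt_const S ((a * b) ^ 4)).sub
      ((hasDerivAt_pow 2 S).const_mul (6 * (a * b) ^ 2))).add
      ((hasDerivAt_pow 3 S).const_mul (4 * (a ^ 2 + b ^ 2)))).sub
      ((hasDerivAt_pow 4 S).const_mul 3)
    refine h.congr_deriv ?_
    push_cast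
    ring
  rw [hd.deriv]
  have : 0 < S * (S - a ^ 2) * (S - b ^ 2) :=
    mul_pos (mul_pos (by nlinarith) (by linarith)) (by linarith)
  linarith

/-- The quartic changes sign exactly once to the right of `a²`. -/
theorem exists_slopeQuartic_sign_change {a b : ℝ} (hb : 0 < b) (hab : b < a) :
    ∃ c, a < c ∧ slopeQuartic a b (c ^ 2) = 0 ∧
      (∀ s, a ≤ s → s < c → 0 < slopeQuartic a b (s ^ 2)) ∧
      ∀ s, c < s → slopeQuartic a b (s ^ 2) < 0 := by
  have ha : 0 < a := hb.trans hab
  have hanti : StrictAntiOn (fun s => slopeQuartic a b (s ^ 2)) (Ici a) := by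
    intro s hs t ht hst
    rw [mem_Ici] at hs ht
    exact strictAntiOn_slopeQuartic hb hab (mem_Ici.2 (by nlinarith)) (mem_Ici.2 (by nlinarith))
      (by nlinarith)
  obtain ⟨m, hm⟩ : ∃ m, m = 2 * (a + b) := ⟨_, rfl⟩
  have hneg : slopeQuartic a b (m ^ 2) ≤ 0 := by
    have e : slopeQuartic a b (m ^ 2) = (a * b) ^ 2 * ((a * b) ^ 2 - 6 * m ^ 4)
        - m ^ 6 * (3 * m ^ 2 - 4 * (a ^ 2 + b ^ 2)) := by
      unfold slopeQuartic; ring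
    have hP : 0 < a * b := mul_pos ha hb
    have h1 : 0 ≤ 3 * m ^ 2 - 4 * (a ^ 2 + b ^ 2) := by rw [hm]; nlinarith
    have h2 : (a * b) ≤ m ^ 2 := by rw [hm]; nlinarith
    have h3 : (a * b) ^ 2 ≤ m ^ 4 := by
      calc (a * b) ^ 2 ≤ (m ^ 2) ^ 2 := pow_le_pow_left₀ hP.le h2 2
        _ = m ^ 4 := by ring
    have h4 : 0 ≤ m ^ 4 := by positivity
    have h5 : 0 ≤ m ^ 6 * (3 * m ^ 2 - 4 * (a ^ 2 + b ^ 2)) := by positivity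
    have h6 : (a * b) ^ 2 * ((a * b) ^ 2 - 6 * m ^ 4) ≤ 0 :=
      mul_nonpos_of_nonneg_of_nonpos (by positivity) (by linarith)
    linarith
  obtain ⟨c, hc, hc0⟩ : (0 : ℝ) ∈ (fun s => slopeQuartic a b (s ^ 2)) '' Icc a m :=
    intermediate_value_Icc' (by rw [hm]; linarith) (by unfold slopeQuartic; fun_prop)
      ⟨hneg, (slopeQuartic_pos_sq_a hb hab).le⟩
  have hac : a < c := by
    refine hc.1.lt_of_ne ?_
    rintro rfl
    exact (slopeQuartic_pos_sq_a hb hab).ne' hc0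
  refine ⟨c, hac, hc0, fun s h1 h2 => ?_, fun s h1 => ?_⟩
  · exact hc0.symm.trans_lt (hanti h1 hac.le h2)
  · exact (hanti hac.le (hac.trans h1).le h1).trans_eq hc0

theorem hasDerivAt_phi {a b s : ℝ} (hs : s ≠ 0) (hD : 0 < (s ^ 2 - a ^ 2) * (s ^ 2 - b ^ 2)) :
    HasDerivAt (phi a b) ((s - (a * b) ^ 2 / s ^ 3) / phi a b s) s := by
  have hq : HasDerivAt (fun s : ℝ => (s ^ 2 - a ^ 2) * (s ^ 2 - b ^ 2) / s ^ 2)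
      (2 * (s - (a * b) ^ 2 / s ^ 3)) s := by
    have h := ((((hasDerivAt_pow 2 s).sub_const (a ^ 2)).mul
      ((hasDerivAt_pow 2 s).sub_const (b ^ 2))).div (hasDerivAt_pow 2 s) (pow_ne_zero 2 hs))
    refine h.congr_deriv ?_
    push_cast
    simp only [Pi.mul_apply]
    field_simp
    ring
  refine (hq.sqrt (div_pos hD (by positivity)).ne').congr_deriv ?_
  rw [mul_div_mul_left _ _ two_ne_zero, phi]

theorem phi_pos {a b s : ℝ} (hs : s ≠ 0) (hD : 0 < (s ^ 2 - a ^ 2) * (s ^ 2 - b ^ 2)) :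
    0 < phi a b s :=
  Real.sqrt_pos.2 (div_pos hD (by positivity))

theorem slopeQuartic_eq {a b s : ℝ} (hs : s ≠ 0)
    (hD : 0 ≤ (s ^ 2 - a ^ 2) * (s ^ 2 - b ^ 2)) :
    slopeQuartic a b (s ^ 2)
      = (s ^ 2) ^ 3 * ((s - (a * b) ^ 2 / s ^ 3) ^ 2 - (2 * phi a b s) ^ 2) := by
  have h : phi a b s ^ 2 = (s ^ 2 - a ^ 2) * (s ^ 2 - b ^ 2) / s ^ 2 :=
    Real.sq_sqrt (div_nonneg hD (sq_nonneg s))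
  rw [mul_pow 2, h, slopeQuartic]
  field_simp
  ring

theorem strictAntiOn_hPlus {a b : ℝ} (hb : 0 < b) (hab : b < a) :
    StrictAntiOn (hPlus a b) (Ioc 0 b) := by
  refine strictAntiOn_of_deriv_neg (convex_Ioc _ _)
    ((continuousOn_hPlus a b).mono fun s hs => hs.1.ne') ?_
  intro s hs
  rw [interior_Ioc, mem_Ioo] at hs
  have hs2 : s ^ 2 < b ^ 2 := by nlinarith [hs.1]
  have hba : b ^ 2 < a ^ 2 := by nlinarith
  have hD : 0 < (s ^ 2 - a ^ 2) * (s ^ 2 - b ^ 2) :=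
    mul_pos_of_neg_of_neg (by linarith) (by linarith)
  have hφ := phi_pos hs.1.ne' hD
  have hd : HasDerivAt (hPlus a b) (2 * 1 + (s - (a * b) ^ 2 / s ^ 3) / phi a b s) s :=
    ((hasDerivAt_id s).const_mul 2).add (hasDerivAt_phi hs.1.ne' hD)
  have hs2' : 0 < s ^ 2 := pow_pos hs.1 2
  have hq := slopeQuartic_pos hb hab hs2' hs2.le
  rw [slopeQuartic_eq hs.1.ne' hD.le] at hq
  have h1 := pos_of_mul_pos_right hq (by positivity)
  have h2 : 0 ≤ (a * b) ^ 2 / s ^ 3 - s := by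
    have hs3 : 0 < s ^ 3 := pow_pos hs.1 3
    rw [sub_nonneg, le_div_iff₀ hs3]
    nlinarith [mul_pos hb hb]
  have h3 : 2 * phi a b s < (a * b) ^ 2 / s ^ 3 - s :=
    lt_of_pow_lt_pow_left₀ 2 h2 (by linarith)
  rw [hd.deriv, ← lt_neg_iff_add_neg', div_lt_iff₀ hφ]
  linarith

theorem sq_sub_mul_sq_sub_pos {a b s : ℝ} (hb : 0 < b) (hab : b < a) (hs : a < s) :
    0 < (s ^ 2 - a ^ 2) * (s ^ 2 - b ^ 2) :=
  mul_pos (by nlinarith) (by nlinarith)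

theorem hasDerivAt_hMinus {a b s : ℝ} (hb : 0 < b) (hab : b < a) (hs : a < s) :
    HasDerivAt (hMinus a b) (2 * 1 - (s - (a * b) ^ 2 / s ^ 3) / phi a b s) s :=
  ((hasDerivAt_id s).const_mul 2).sub
    (hasDerivAt_phi ((hb.trans hab).trans hs).ne' (sq_sub_mul_sq_sub_pos hb hab hs))

/-- To the right of `a` the derivative of `2 s - φ(s)` is a positive multiple of
`-slopeQuartic a b s²`. -/
theorem exists_slopeQuartic_eq_neg_mul_deriv {a b s : ℝ} (hb : 0 < b) (hab : b < a)
    (hs : a < s) :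
    ∃ m > 0, slopeQuartic a b (s ^ 2) = -(m * deriv (hMinus a b) s) := by
  have ha : 0 < a := hb.trans hab
  have hs0 : 0 < s := ha.trans hs
  have hD := sq_sub_mul_sq_sub_pos hb hab hs
  have hφ := phi_pos hs0.ne' hD
  have h2 : 0 < s - (a * b) ^ 2 / s ^ 3 := by
    rw [sub_pos, div_lt_iff₀ (pow_pos hs0 3)]
    have h1 : a * b < s * s := mul_lt_mul'' hs (hab.trans hs) ha.le hb.le
    nlinarith [mul_pos ha hb]
  refine ⟨(s ^ 2) ^ 3 * (s - (a * b) ^ 2 / s ^ 3 + 2 * phi a b s) * phi a b s, by positivity, ?_⟩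
  rw [slopeQuartic_eq hs0.ne' hD.le, (hasDerivAt_hMinus hb hab hs).deriv]
  generalize s - (a * b) ^ 2 / s ^ 3 = u
  field_simp
  ring

theorem exists_deriv_hMinus_sign_change {a b : ℝ} (hb : 0 < b) (hab : b < a) :
    a < s₀ a b ∧ {s : ℝ | a < s ∧ deriv (hMinus a b) s = 0} = {s₀ a b} ∧
      (∀ s, a < s → s < s₀ a b → deriv (hMinus a b) s < 0) ∧
      ∀ s, s₀ a b < s → 0 < deriv (hMinus a b) s := by
  obtain ⟨c, hac, hc0, hc1, hc2⟩ := exists_slopeQuartic_sign_change hb hab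
  have h1 : ∀ s, a < s → s < c → deriv (hMinus a b) s < 0 := by
    intro s hs hsc
    obtain ⟨m, hm, he⟩ := exists_slopeQuartic_eq_neg_mul_deriv hb hab hs
    have h := hc1 s hs.le hsc
    rw [he] at h
    by_contra! h'
    have := mul_nonneg hm.le h'
    linarith
  have h2 : ∀ s, c < s → 0 < deriv (hMinus a b) s := by
    intro s hsc
    obtain ⟨m, hm, he⟩ := exists_slopeQuartic_eq_neg_mul_deriv hb hab (hac.trans hsc)
    have h := hc2 s hsc
    rw [he] at h
    exact pos_of_mul_pos_right (by linarith) hm.le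
  have h3 : {s : ℝ | a < s ∧ deriv (hMinus a b) s = 0} = {c} := by
    ext s
    constructor
    · rintro ⟨hs, hd⟩
      rcases lt_trichotomy s c with h | h | h
      · exact absurd hd (h1 s hs h).ne
      · exact h
      · exact absurd hd (h2 s h).ne'
    · rintro rfl
      obtain ⟨m, hm, he⟩ := exists_slopeQuartic_eq_neg_mul_deriv hb hab hac
      rw [hc0] at he
      exact ⟨hac, (mul_eq_zero.1 (by linarith)).resolve_left hm.ne'⟩
  have h4 : s₀ a b = c := by rw [s₀, h3, csInf_singleton]
  rw [h4]
  exact ⟨hac, h3, h1, h2⟩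

theorem strictAntiOn_hMinus {a b : ℝ} (hb : 0 < b) (hab : b < a) :
    StrictAntiOn (hMinus a b) (Icc a (s₀ a b)) := by
  obtain ⟨-, -, h, -⟩ := exists_deriv_hMinus_sign_change hb hab
  refine strictAntiOn_of_deriv_neg (convex_Icc _ _)
    ((continuousOn_hMinus a b).mono fun s hs => ((hb.trans hab).trans_le hs.1).ne') ?_
  intro s hs
  rw [interior_Icc] at hs
  exact h s hs.1 hs.2

theorem strictMonoOn_hMinus {a b : ℝ} (hb : 0 < b) (hab : b < a) :
    StrictMonoOn (hMinus a b) (Ici (s₀ a b)) := by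
  obtain ⟨h0, -, -, h⟩ := exists_deriv_hMinus_sign_change hb hab
  refine strictMonoOn_of_deriv_pos (convex_Ici _)
    ((continuousOn_hMinus a b).mono fun s hs => (((hb.trans hab).trans h0).trans_le hs).ne') ?_
  intro s hs
  rw [interior_Ici] at hs
  exact h s hs

/-! ### Ranges of `2 s ± φ(s)` -/

theorem hPlus_neg_b (a b : ℝ) : hPlus a b (-b) = -2 * b := by
  rw [hPlus, phi_eq_zero_of_sq_eq_b (neg_sq b)]; ring

theorem hPlus_b (a b : ℝ) : hPlus a b b = 2 * b := by
  rw [hPlus, phi_eq_zero_of_sq_eq_b rfl, add_zero]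

theorem hMinus_a (a b : ℝ) : hMinus a b a = 2 * a := by
  rw [hMinus, phi_eq_zero_of_sq_eq_a rfl, sub_zero]

/-- `φ` is unbounded near `0`. -/
theorem exists_le_phi {a b : ℝ} (hb : 0 < b) (hab : b < a) (y : ℝ) :
    ∃ ε ∈ Ioc 0 b, y + 2 * ε ≤ phi a b ε := by
  obtain ⟨M, hM⟩ : ∃ M, M = |y| + 4 * b := ⟨_, rfl⟩
  have hy := le_abs_self y
  have hy0 := abs_nonneg y
  have hM0 : 0 < M := by linarith
  obtain ⟨ε, hε⟩ : ∃ ε, ε = b ^ 2 / M := ⟨_, rfl⟩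
  have hε0 : 0 < ε := by rw [hε]; positivity
  have hεb : ε ≤ b / 4 := by
    rw [hε, div_le_iff₀ hM0]
    nlinarith
  have hεM : b ^ 2 / ε = M := by rw [hε]; field_simp
  refine ⟨ε, ⟨hε0, by linarith⟩, ?_⟩
  refine le_trans (b := M - ε) (by linarith) ?_
  refine Real.le_sqrt_of_sq_le ?_
  rw [← hεM, le_div_iff₀ (by positivity)]
  have e : (b ^ 2 / ε - ε) ^ 2 * ε ^ 2 = (b ^ 2 - ε ^ 2) * (b ^ 2 - ε ^ 2) := by
    field_simp
  rw [e]
  have h1 : 0 ≤ b ^ 2 - ε ^ 2 := by nlinarith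
  nlinarith [mul_nonneg h1 (by nlinarith : 0 ≤ a ^ 2 - b ^ 2)]

theorem bijOn_hPlus_neg {a b : ℝ} (hb : 0 < b) (hab : b < a) :
    BijOn (hPlus a b) (Ico (-b) 0) (Ici (-2 * b)) := by
  refine ⟨fun s hs => ?_, (strictMonoOn_hPlus hb hab).injOn, fun y hy => ?_⟩
  · rw [mem_Ici, ← hPlus_neg_b a b]
    exact (strictMonoOn_hPlus hb hab).monotoneOn ⟨le_rfl, by linarith⟩ hs hs.1
  · obtain ⟨ε, hε, hεy⟩ := exists_le_phi hb hab y
    have hcont : ContinuousOn (hPlus a b) (Icc (-b) (-ε)) :=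
      (continuousOn_hPlus a b).mono fun s hs => (hs.2.trans_lt (by linarith [hε.1])).ne
    obtain ⟨s, hs, hsy⟩ := intermediate_value_Icc (by linarith [hε.2]) hcont
      ⟨(hPlus_neg_b a b).trans_le hy, by rw [hPlus, phi_neg]; linarith⟩
    exact ⟨s, ⟨hs.1, hs.2.trans_lt (by linarith [hε.1])⟩, hsy⟩

theorem bijOn_hPlus_pos {a b : ℝ} (hb : 0 < b) (hab : b < a) :
    BijOn (hPlus a b) (Ioc 0 b) (Ici (2 * b)) := by
  refine ⟨fun s hs => ?_, (strictAntiOn_hPlus hb hab).injOn, fun y hy => ?_⟩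
  · rw [mem_Ici, ← hPlus_b a b]
    exact (strictAntiOn_hPlus hb hab).antitoneOn hs ⟨hb, le_rfl⟩ hs.2
  · obtain ⟨ε, hε, hεy⟩ := exists_le_phi hb hab y
    have hcont : ContinuousOn (hPlus a b) (Icc ε b) :=
      (continuousOn_hPlus a b).mono fun s hs => (hε.1.trans_le hs.1).ne'
    obtain ⟨s, hs, hsy⟩ := intermediate_value_Icc' hε.2 hcont
      ⟨(hPlus_b a b).trans_le hy, by rw [hPlus]; linarith [hε.1]⟩
    exact ⟨s, ⟨hε.1.trans_le hs.1, hs.2⟩, hsy⟩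

theorem bijOn_hMinus_Icc {a b : ℝ} (hb : 0 < b) (hab : b < a) :
    BijOn (hMinus a b) (Icc a (s₀ a b)) (Icc (h₀ a b) (2 * a)) := by
  obtain ⟨h0, -⟩ := exists_deriv_hMinus_sign_change hb hab
  have hanti := (strictAntiOn_hMinus hb hab).antitoneOn
  refine ⟨fun s hs => ⟨?_, ?_⟩, (strictAntiOn_hMinus hb hab).injOn, ?_⟩
  · exact hanti hs ⟨h0.le, le_rfl⟩ hs.2
  · rw [← hMinus_a a b]
    exact hanti ⟨le_rfl, h0.le⟩ hs hs.1
  · rw [← hMinus_a a b, h₀]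
    exact intermediate_value_Icc' h0.le
      ((continuousOn_hMinus a b).mono fun s hs => ((hb.trans hab).trans_le hs.1).ne')

theorem le_hMinus_of_le {a b s : ℝ} (hb : 0 < b) (hab : b < a) (hs : a ≤ s) :
    s ≤ hMinus a b s := by
  have hs0 : 0 < s := (hb.trans hab).trans_le hs
  have h : phi a b s ≤ s := by
    refine Real.sqrt_le_iff.2 ⟨hs0.le, ?_⟩
    rw [div_le_iff₀ (by positivity)]
    nlinarith [sq_nonneg a, sq_nonneg b, mul_nonneg (sq_nonneg a) (by nlinarith : 0 ≤ s ^ 2 - b ^ 2),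
      mul_nonneg (sq_nonneg b) (sq_nonneg s)]
  rw [hMinus]
  linarith

theorem bijOn_hMinus_Ici {a b : ℝ} (hb : 0 < b) (hab : b < a) :
    BijOn (hMinus a b) (Ici (s₀ a b)) (Ici (h₀ a b)) := by
  obtain ⟨h0, -⟩ := exists_deriv_hMinus_sign_change hb hab
  refine ⟨fun s hs => ?_, (strictMonoOn_hMinus hb hab).injOn, fun y hy => ?_⟩
  · exact (strictMonoOn_hMinus hb hab).monotoneOn self_mem_Ici hs hs
  · have hm : s₀ a b ≤ max (s₀ a b) y := le_max_left _ _
    have hcont : ContinuousOn (hMinus a b) (Icc (s₀ a b) (max (s₀ a b) y)) :=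
      (continuousOn_hMinus a b).mono fun s hs => (((hb.trans hab).trans h0).trans_le hs.1).ne'
    obtain ⟨s, hs, hsy⟩ := intermediate_value_Icc hm hcont
      ⟨hy, (le_max_right _ _).trans (le_hMinus_of_le hb hab (h0.le.trans hm))⟩
    exact ⟨s, hs.1, hsy⟩

/-- Since `φ(s)² = (s - a)(s - b) · (s + a)(s + b) / s² < 4 (s - a)(s - b)` for `s > a`. -/
theorem add_lt_hMinus {a b s : ℝ} (hb : 0 < b) (hab : b < a) (hs : a ≤ s) :
    a + b < hMinus a b s := by
  have ha : 0 < a := hb.trans hab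
  have hs0 : 0 < s := ha.trans_le hs
  have h : phi a b s < 2 * s - (a + b) := by
    refine (Real.sqrt_lt' (by linarith)).2 ?_
    rw [div_lt_iff₀ (by positivity)]
    have h1 : (s + a) * (s + b) ≤ 4 * s ^ 2 := by nlinarith
    have h2 : 0 ≤ (s - a) * (s - b) := mul_nonneg (by linarith) (by linarith)
    have h3 := mul_le_mul_of_nonneg_left h1 h2
    have h4 : 4 * ((s - a) * (s - b)) < (2 * s - (a + b)) ^ 2 := by
      nlinarith [mul_pos (sub_pos.2 hab) (sub_pos.2 hab)]
    have h5 := mul_lt_mul_of_pos_right h4 (by positivity : 0 < s ^ 2)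
    linarith
  rw [hMinus]
  linarith

theorem h₀_mem_Ioo {a b : ℝ} (hb : 0 < b) (hab : b < a) : h₀ a b ∈ Ioo (a + b) (2 * a) := by
  obtain ⟨h0, -⟩ := exists_deriv_hMinus_sign_change hb hab
  refine ⟨add_lt_hMinus hb hab h0.le, ?_⟩
  rw [← hMinus_a a b]
  exact strictAntiOn_hMinus hb hab ⟨le_rfl, h0.le⟩ ⟨h0.le, le_rfl⟩ h0

/-- `h₀` is the minimum of `2 s - φ(s)` on `[a, ∞)`. -/
theorem h₀_le_hMinus {a b s : ℝ} (hb : 0 < b) (hab : b < a) (hs : a ≤ s) :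
    h₀ a b ≤ hMinus a b s := by
  rcases le_total s (s₀ a b) with h | h
  · exact ((bijOn_hMinus_Icc hb hab).mapsTo ⟨hs, h⟩).1
  · exact (bijOn_hMinus_Ici hb hab).mapsTo h

/-! ### The inverse functions and the admissible parameters -/

theorem s₁_mem {a b h : ℝ} (hb : 0 < b) (hab : b < a) (hh : -2 * b ≤ h) :
    s₁ a b h ∈ Ico (-b) 0 ∧ hPlus a b (s₁ a b h) = h :=
  have hs := (bijOn_hPlus_neg hb hab).surjOn hh
  ⟨Function.invFunOn_mem hs, Function.invFunOn_eq hs⟩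

theorem s₂_mem {a b h : ℝ} (hb : 0 < b) (hab : b < a) (hh : 2 * b ≤ h) :
    s₂ a b h ∈ Ioc 0 b ∧ hPlus a b (s₂ a b h) = h :=
  have hs := (bijOn_hPlus_pos hb hab).surjOn hh
  ⟨Function.invFunOn_mem hs, Function.invFunOn_eq hs⟩

theorem s₃_mem {a b h : ℝ} (hb : 0 < b) (hab : b < a) (hh : h ∈ Icc (h₀ a b) (2 * a)) :
    s₃ a b h ∈ Icc a (s₀ a b) ∧ hMinus a b (s₃ a b h) = h :=
  have hs := (bijOn_hMinus_Icc hb hab).surjOn hh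
  ⟨Function.invFunOn_mem hs, Function.invFunOn_eq hs⟩

theorem s₄_mem {a b h : ℝ} (hb : 0 < b) (hab : b < a) (hh : h₀ a b ≤ h) :
    s₄ a b h ∈ Ici (s₀ a b) ∧ hMinus a b (s₄ a b h) = h :=
  have hs := (bijOn_hMinus_Ici hb hab).surjOn hh
  ⟨Function.invFunOn_mem hs, Function.invFunOn_eq hs⟩

theorem hPlus_le_iff_of_neg {a b s h : ℝ} (hb : 0 < b) (hab : b < a) (hs : s ∈ Ico (-b) 0)
    (hh : -2 * b ≤ h) : hPlus a b s ≤ h ↔ s ≤ s₁ a b h := by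
  obtain ⟨hm, he⟩ := s₁_mem hb hab hh
  rw [← (strictMonoOn_hPlus hb hab).le_iff_le hs hm, he]

theorem hPlus_le_iff_of_pos {a b s h : ℝ} (hb : 0 < b) (hab : b < a) (hs : s ∈ Ioc 0 b)
    (hh : 2 * b ≤ h) : hPlus a b s ≤ h ↔ s₂ a b h ≤ s := by
  obtain ⟨hm, he⟩ := s₂_mem hb hab hh
  rw [← (strictAntiOn_hPlus hb hab).le_iff_ge hs hm, he]

theorem le_hMinus_iff_le {a b s h : ℝ} (hb : 0 < b) (hab : b < a) (hs : s ∈ Icc a (s₀ a b))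
    (hh : h ∈ Icc (h₀ a b) (2 * a)) : h ≤ hMinus a b s ↔ s ≤ s₃ a b h := by
  obtain ⟨hm, he⟩ := s₃_mem hb hab hh
  rw [← (strictAntiOn_hMinus hb hab).le_iff_ge hm hs, he]

theorem le_hMinus_iff_ge {a b s h : ℝ} (hb : 0 < b) (hab : b < a) (hs : s₀ a b ≤ s)
    (hh : h₀ a b ≤ h) : h ≤ hMinus a b s ↔ s₄ a b h ≤ s := by
  obtain ⟨hm, he⟩ := s₄_mem hb hab hh
  rw [← (strictMonoOn_hMinus hb hab).le_iff_le hm hs, he]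

theorem add_div_le_iff {a b s h : ℝ} (hs : s < 0) :
    s + a * b / s ≤ h ↔ 0 ≤ s ^ 2 - h * s + a * b := by
  have hne := hs.ne
  have e : s ^ 2 - h * s + a * b = (s + a * b / s - h) * s := by field_simp; ring
  rw [e]
  refine ⟨fun h1 => mul_nonneg_of_nonpos_of_nonpos (by linarith) hs.le, fun h1 => ?_⟩
  have := nonpos_of_mul_nonneg_left h1 hs
  linarith

theorem sub_div_le_iff {a b s h : ℝ} (hb : 0 < b) (hab : b < a) (hs : 0 < s) :
    s - a * b / s ≤ h ↔ s ≤ s₇ a b h := by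
  have hP : 0 < a * b := mul_pos (hb.trans hab) hb
  have hr : √(h ^ 2 + 4 * (a * b)) ^ 2 = h ^ 2 + 4 * (a * b) := Real.sq_sqrt (by positivity)
  have hr0 := Real.sqrt_nonneg (h ^ 2 + 4 * (a * b))
  have hrh : |h| < √(h ^ 2 + 4 * (a * b)) := by
    refine Real.lt_sqrt_of_sq_lt ?_
    rw [sq_abs]
    linarith
  unfold s₇
  generalize √(h ^ 2 + 4 * (a * b)) = r at hr hr0 hrh ⊢
  -- the other root `(h - r) / 2` is negative
  have h1 : 0 < s - (h - r) / 2 := by linarith [le_abs_self h]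
  have e : (s - a * b / s - h) * s = (s - (h + r) / 2) * (s - (h - r) / 2) := by
    field_simp
    linear_combination hr
  constructor
  · intro h2
    have h3 : (s - (h + r) / 2) * (s - (h - r) / 2) ≤ 0 :=
      e.symm.trans_le (mul_nonpos_of_nonpos_of_nonneg (by linarith) hs.le)
    by_contra! h4
    have := mul_pos (by linarith : 0 < s - (h + r) / 2) h1
    linarith
  · intro h2
    have h3 : (s - a * b / s - h) * s ≤ 0 :=
      e.trans_le (mul_nonpos_of_nonpos_of_nonneg (by linarith) h1.le)
    by_contra! h4
    have := mul_pos (by linarith : 0 < s - a * b / s - h) hs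
    linarith

theorem sqrt_mul_bounds {a b : ℝ} (hb : 0 < b) (hab : b < a) :
    b < √(a * b) ∧ √(a * b) ^ 2 = a * b :=
  ⟨Real.lt_sqrt_of_sq_lt (by nlinarith), Real.sq_sqrt (mul_pos (hb.trans hab) hb).le⟩

theorem le_s₅_or_s₆_le_iff {a b s h : ℝ} (hb : 0 < b) (hab : b < a) (hh : h ≤ -2 * √(a * b)) :
    s ≤ s₅ a b h ∨ s₆ a b h ≤ s ↔ 0 ≤ s ^ 2 - h * s + a * b := by
  obtain ⟨hm, hm2⟩ := sqrt_mul_bounds hb hab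
  have hD : 0 ≤ h ^ 2 - 4 * (a * b) := by nlinarith
  have hr := Real.sq_sqrt hD
  have hr0 := Real.sqrt_nonneg (h ^ 2 - 4 * (a * b))
  unfold s₅ s₆
  generalize √(h ^ 2 - 4 * (a * b)) = r at hr hr0 ⊢
  have e : s ^ 2 - h * s + a * b = (s - (h - r) / 2) * (s - (h + r) / 2) := by
    linear_combination hr / 4
  rw [e, mul_nonneg_iff]
  constructor
  · rintro (h1 | h1)
    · exact Or.inr ⟨by linarith, by linarith⟩
    · exact Or.inl ⟨by linarith, by linarith⟩
  · rintro (h1 | h1)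
    · exact Or.inr (by linarith [h1.2])
    · exact Or.inl (by linarith [h1.1])

theorem negRegion_iff_admissible {a b s h : ℝ} (hb : 0 < b) (hab : b < a) (hs : s < 0) :
    NegRegion a b s h ↔ Admissible a b s h := by
  have ha : 0 < a := hb.trans hab
  obtain ⟨hm, hm2⟩ := sqrt_mul_bounds hb hab
  have hmid : -2 * √(a * b) ≤ h → s + a * b / s ≤ h := fun h1 => by
    rw [add_div_le_iff hs]
    nlinarith [sq_nonneg (s + √(a * b)), mul_nonneg_of_nonpos_of_nonpos hs.le
      (by linarith : -2 * √(a * b) - h ≤ 0)]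
  constructor
  · rintro (⟨h1, h2, h3⟩ | ⟨h1, h2, h3, h4⟩ | ⟨h1, h3, h4⟩)
    · have h0 : s ≤ s₅ a b h ∨ s₆ a b h ≤ s := h3.imp And.right And.left
      rw [le_s₅_or_s₆_le_iff hb hab h2, ← add_div_le_iff hs] at h0
      have hr0 := Real.sqrt_nonneg (h ^ 2 - 4 * (a * b))
      rcases h3 with ⟨h3, h4⟩ | ⟨h3, h4⟩
      · refine Or.inl ⟨h3, ?_, h0⟩
        rw [s₅] at h4
        linarith
      · refine Or.inl ⟨?_, h4, h0⟩
        rw [s₆] at h3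
        linarith
    · exact Or.inl ⟨h3, h4, hmid h1⟩
    · rcases le_total s (-b) with h5 | h5
      · exact Or.inl ⟨h3, h5, hmid (by linarith)⟩
      · refine Or.inr (Or.inl ⟨hs.ne, h5, by linarith, ?_⟩)
        exact (hPlus_le_iff_of_neg hb hab ⟨h5, hs⟩ h1.le).2 h4
  · rintro (⟨h1, h2, h3⟩ | ⟨-, h1, -, h2⟩ | ⟨h1, -⟩ | ⟨h1, -⟩)
    · have h4 : -(a + b) ≤ h := by
        refine le_trans ?_ h3
        have hne := hs.ne
        have e : (s + a * b / s + (a + b)) * s = (s + a) * (s + b) := by field_simp; ring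
        have h5 : (s + a * b / s + (a + b)) * s ≤ 0 :=
          e.trans_le (mul_nonpos_of_nonneg_of_nonpos (by linarith) (by linarith))
        by_contra! h6
        have := mul_pos_of_neg_of_neg (by linarith : s + a * b / s + (a + b) < 0) hs
        linarith
      rcases le_total h (-2 * √(a * b)) with h5 | h5
      · refine Or.inl ⟨h4, h5, ?_⟩
        have h6 := (le_s₅_or_s₆_le_iff hb hab h5).2 ((add_div_le_iff hs).1 h3)
        exact h6.imp (fun h => ⟨h1, h⟩) (fun h => ⟨h, h2⟩)
      rcases le_or_gt h (-2 * b) with h6 | h6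
      · exact Or.inr (Or.inl ⟨h5, h6, h1, h2⟩)
      · exact Or.inr (Or.inr ⟨h6, h1, h2.trans (s₁_mem hb hab h6.le).1.1⟩)
    · have h3 : -2 * b ≤ h := ((bijOn_hPlus_neg hb hab).mapsTo ⟨h1, hs⟩).trans h2
      have h4 := (hPlus_le_iff_of_neg hb hab ⟨h1, hs⟩ h3).1 h2
      rcases h3.eq_or_lt with rfl | h5
      · -- here `h = -2 b` forces `s = -b`
        have h6 : s ≤ -b := by
          rw [← (strictMonoOn_hPlus hb hab).le_iff_le ⟨h1, hs⟩ ⟨le_rfl, by linarith⟩,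
            hPlus_neg_b]
          exact h2
        exact Or.inr (Or.inl ⟨by linarith, le_rfl, by linarith, h6⟩)
      · exact Or.inr (Or.inr ⟨h5, by linarith, h4⟩)
    · linarith
    · linarith

theorem sub_div_le_sub_div {a b s t : ℝ} (hb : 0 < b) (hab : b < a) (hs : 0 < s) (hst : s ≤ t) :
    s - a * b / s ≤ t - a * b / t := by
  have := div_le_div_of_nonneg_left (mul_pos (hb.trans hab) hb).le hs hst
  linarith

theorem sub_div_le_hMinus {a b s : ℝ} (hb : 0 < b) (hab : b < a) (hs : 0 < s) :
    s - a * b / s ≤ hMinus a b s := by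
  have h := (phi_le_abs (a := a) (b := b) hs.ne').1
  have : 0 < a * b / s := div_pos (mul_pos (hb.trans hab) hb) hs
  rw [abs_of_pos (by linarith)] at h
  rw [hMinus]
  linarith

theorem posRegion_iff_admissible {a b s h : ℝ} (hb : 0 < b) (hab : b < a) (hs : 0 < s) :
    PosRegion a b s h ↔ Admissible a b s h := by
  have ha : 0 < a := hb.trans hab
  obtain ⟨h01, h02⟩ := h₀_mem_Ioo hb hab
  have hea : a - a * b / a = a - b := by rw [mul_div_cancel_left₀ _ ha.ne']
  have heb : b - a * b / b = b - a := by rw [mul_div_cancel_right₀ _ hb.ne']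
  -- the admissible parameters over `[s₂(h), a]`
  have hleft : 2 * b ≤ h → s₂ a b h ≤ s → s ≤ a → s - a * b / s ≤ h → Admissible a b s h := by
    intro h1 h2 h3 h4
    rcases le_total s b with h5 | h5
    · exact Or.inr (Or.inl ⟨hs.ne', by linarith, h5,
        (hPlus_le_iff_of_pos hb hab ⟨hs, h5⟩ h1).2 h2⟩)
    · exact Or.inr (Or.inr (Or.inl ⟨h5, h3, h4⟩))
  have hright : h₀ a b ≤ h → s ∈ Icc (s₄ a b h) (s₇ a b h) → Admissible a b s h := by
    intro h1 h2
    have h3 := (exists_deriv_hMinus_sign_change hb hab).1.le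
    have h4 : s₀ a b ≤ s := (s₄_mem hb hab h1).1.trans h2.1
    exact Or.inr (Or.inr (Or.inr ⟨h3.trans h4, (sub_div_le_iff hb hab hs).2 h2.2,
      (le_hMinus_iff_ge hb hab h4 h1).2 h2.1⟩))
  constructor
  · rintro (⟨h1, h2, h3, h4⟩ | ⟨h1, h2, h3, h4⟩ | ⟨h1, h2, ⟨h3, h4⟩ | h3⟩ |
      ⟨h1, ⟨h3, h4⟩ | h3⟩)
    · rw [← sub_div_le_iff hb hab hs] at h4
      rcases le_total s a with h5 | h5
      · exact Or.inr (Or.inr (Or.inl ⟨h3, h5, h4⟩))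
      · exact Or.inr (Or.inr (Or.inr ⟨h5, h4, by linarith [add_lt_hMinus hb hab h5]⟩))
    · rw [← sub_div_le_iff hb hab hs] at h4
      rcases le_total s a with h5 | h5
      · exact hleft h1 h3 h5 h4
      · exact Or.inr (Or.inr (Or.inr ⟨h5, h4, h2.trans (h₀_le_hMinus hb hab h5)⟩))
    · obtain ⟨h5, h6⟩ := s₃_mem hb hab ⟨h1, h2⟩
      have h7 : s - a * b / s ≤ h := (sub_div_le_sub_div hb hab hs h4).trans
        ((sub_div_le_hMinus hb hab (ha.trans_le h5.1)).trans_eq h6)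
      rcases le_total s a with h8 | h8
      · exact hleft (by linarith) h3 h8 h7
      · exact Or.inr (Or.inr (Or.inr ⟨h8, h7,
          (le_hMinus_iff_le hb hab ⟨h8, h4.trans h5.2⟩ ⟨h1, h2⟩).2 h4⟩))
    · exact hright h1 h3
    · have := sub_div_le_sub_div hb hab hs h4
      exact hleft (by linarith) h3 h4 (by linarith)
    · exact hright (by linarith) h3
  · intro hadm
    -- the position of `h` decides the system; `s ≥ s₂(h)` holds whenever `s ≥ b`
    have hs₂ : b ≤ s → 2 * b ≤ h → s₂ a b h ≤ s := fun h1 h2 =>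
      (s₂_mem hb hab h2).1.2.trans h1
    have hle : s ≤ a → 2 * b ≤ h → s₂ a b h ≤ s → s - a * b / s ≤ h → PosRegion a b s h := by
      intro h1 h2 h3 h4
      rcases le_total h (h₀ a b) with h5 | h5
      · exact Or.inr (Or.inl ⟨h2, h5, h3, (sub_div_le_iff hb hab hs).1 h4⟩)
      rcases le_or_gt h (2 * a) with h6 | h6
      · exact Or.inr (Or.inr (Or.inl ⟨h5, h6, Or.inl
          ⟨h3, h1.trans (s₃_mem hb hab ⟨h5, h6⟩).1.1⟩⟩))
      · exact Or.inr (Or.inr (Or.inr ⟨h6, Or.inl ⟨h3, h1⟩⟩))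
    rcases hadm with ⟨-, h1, -⟩ | ⟨-, -, h1, h2⟩ | ⟨h1, h2, h3⟩ | ⟨h1, h2, h3⟩
    · linarith
    · have h3 : 2 * b ≤ h := ((bijOn_hPlus_pos hb hab).mapsTo ⟨hs, h1⟩).trans h2
      have h4 := sub_div_le_sub_div hb hab hs h1
      exact hle (by linarith) h3 ((hPlus_le_iff_of_pos hb hab ⟨hs, h1⟩ h3).1 h2) (by linarith)
    · rcases le_total h (2 * b) with h4 | h4
      · have := sub_div_le_sub_div hb hab hb h1
        exact Or.inl ⟨by linarith, h4, h1, (sub_div_le_iff hb hab hs).1 h3⟩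
      · exact hle h2 h4 (hs₂ h1 h4) h3
    · have h4 := sub_div_le_sub_div hb hab ha h1
      have h5 := (sub_div_le_iff hb hab hs).1 h2
      have hbs : b ≤ s := hab.le.trans h1
      rcases le_total h (2 * b) with h6 | h6
      · exact Or.inl ⟨by linarith, h6, hbs, h5⟩
      rcases le_total h (h₀ a b) with h7 | h7
      · exact Or.inr (Or.inl ⟨h6, h7, hs₂ hbs h6, h5⟩)
      have hge : s₀ a b ≤ s → s ∈ Icc (s₄ a b h) (s₇ a b h) := fun h8 =>
        ⟨(le_hMinus_iff_ge hb hab h8 h7).1 h3, h5⟩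
      rcases le_or_gt h (2 * a) with h8 | h8
      · refine Or.inr (Or.inr (Or.inl ⟨h7, h8, ?_⟩))
        rcases le_total s (s₀ a b) with h9 | h9
        · exact Or.inl ⟨hs₂ hbs h6, (le_hMinus_iff_le hb hab ⟨h1, h9⟩ ⟨h7, h8⟩).1 h3⟩
        · exact Or.inr (hge h9)
      · refine Or.inr (Or.inr (Or.inr ⟨h8, Or.inr (hge ?_)⟩))
        by_contra! h9
        have := ((bijOn_hMinus_Icc hb hab).mapsTo ⟨h1, h9.le⟩).2
        linarith

/-! ### The discriminant sheet -/

theorem isMultipleRoot_iff {a b h k g s : ℝ} (hb : 0 < b) (hab : b < a) :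
    IsMultipleRoot a b h k g s ↔ s ≠ 0 ∧ (h, k, g) = sheet4Param a b s h := by
  have hP : 0 < a * b := mul_pos (hb.trans hab) hb
  simp only [IsMultipleRoot, psi, Polynomial.IsRoot.def, Polynomial.derivative_add,
    Polynomial.derivative_sub, Polynomial.derivative_mul, Polynomial.derivative_pow,
    Polynomial.derivative_X, Polynomial.derivative_C, Polynomial.eval_add, Polynomial.eval_sub,
    Polynomial.eval_mul, Polynomial.eval_pow, Polynomial.eval_X, Polynomial.eval_C,
    Polynomial.eval_zero, Polynomial.eval_one, sheet4Param,
    Prod.mk.injEq, true_and]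
  constructor
  · rintro ⟨h1, h2⟩
    have hs : s ≠ 0 := by
      rintro rfl
      have : (a * b) ^ 2 = 0 := by linear_combination h1
      exact hP.ne' (pow_eq_zero_iff two_ne_zero |>.1 this)
    refine ⟨hs, ?_, ?_⟩
    · field_simp
      push_cast at h2
      linear_combination h1 - s * h2
    · field_simp
      push_cast at h2
      linear_combination -h1 + s * h2 / 2
  · rintro ⟨hs, rfl, rfl⟩
    constructor
    · field_simp
      ring
    · push_cast
      field_simp
      ring

theorem sheet4Param_mem_sheet4 {a b s h : ℝ} (hb : 0 < b) (hab : b < a) (hs : s ≠ 0) :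
    sheet4Param a b s h ∈ sheet4 a b :=
  ⟨s, (isMultipleRoot_iff hb hab).2 ⟨hs, rfl⟩⟩

theorem sheet4Param_mem_inter_iff {a b s h : ℝ} (hb : 0 < b) (hab : b < a) (hs : s ≠ 0) :
    sheet4Param a b s h ∈ sheet4 a b ∩ bifDiagram a b ↔ Admissible a b s h := by
  refine ⟨?_, fun hadm => ⟨sheet4Param_mem_sheet4 hb hab hs, hadm.mem_bifDiagram hb hab⟩⟩
  rintro ⟨-, x, hx, hJ⟩
  exact admissible_of_critical hb hab hx hs hJ

end

end KowalevskiTop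

theorem theorem7 (a b : ℝ) (hb : 0 < b) (hab : b < a) :
    -- the inverse functions `s₁, …, s₄` and the numbers `s₀`, `h₀` are well defined
    (StrictMonoOn (hPlus a b) (Set.Ico (-b) 0) ∧
      Set.BijOn (hPlus a b) (Set.Ico (-b) 0) (Set.Ici (-2 * b))) ∧
    (StrictAntiOn (hPlus a b) (Set.Ioc 0 b) ∧
      Set.BijOn (hPlus a b) (Set.Ioc 0 b) (Set.Ici (2 * b))) ∧
    {s : ℝ | a < s ∧ deriv (hMinus a b) s = 0} = {s₀ a b} ∧
    (StrictAntiOn (hMinus a b) (Set.Icc a (s₀ a b)) ∧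
      Set.BijOn (hMinus a b) (Set.Icc a (s₀ a b)) (Set.Icc (h₀ a b) (2 * a))) ∧
    (StrictMonoOn (hMinus a b) (Set.Ici (s₀ a b)) ∧
      Set.BijOn (hMinus a b) (Set.Ici (s₀ a b)) (Set.Ici (h₀ a b))) ∧
    h₀ a b ∈ Set.Ioo (a + b) (2 * a) ∧
    -- `(s, h)`, `s ≠ 0`, are parameters on the sheet
    (∀ h k g s : ℝ, IsMultipleRoot a b h k g s ↔ s ≠ 0 ∧ (h, k, g) = sheet4Param a b s h) ∧
    -- the admissible parameters, for negative and for positive `s`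
    (∀ s h : ℝ, s < 0 →
      (sheet4Param a b s h ∈ sheet4 a b ∩ bifDiagram a b ↔ NegRegion a b s h)) ∧
    (∀ s h : ℝ, 0 < s →
      (sheet4Param a b s h ∈ sheet4 a b ∩ bifDiagram a b ↔ PosRegion a b s h)) ∧
    -- the admissible part of the sheet as a set of points `(h, k, g)`
    sheet4 a b ∩ bifDiagram a b =
      {y : ℝ × ℝ × ℝ | ∃ s h : ℝ,
        ((s < 0 ∧ NegRegion a b s h) ∨ (0 < s ∧ PosRegion a b s h)) ∧
          y = sheet4Param a b s h} := by
  have hneg : ∀ s h : ℝ, s < 0 →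
      (sheet4Param a b s h ∈ sheet4 a b ∩ bifDiagram a b ↔ NegRegion a b s h) := fun s h hs =>
    (sheet4Param_mem_inter_iff hb hab hs.ne).trans (negRegion_iff_admissible hb hab hs).symm
  have hpos : ∀ s h : ℝ, 0 < s →
      (sheet4Param a b s h ∈ sheet4 a b ∩ bifDiagram a b ↔ PosRegion a b s h) := fun s h hs =>
    (sheet4Param_mem_inter_iff hb hab hs.ne').trans (posRegion_iff_admissible hb hab hs).symm
  refine ⟨⟨strictMonoOn_hPlus hb hab, bijOn_hPlus_neg hb hab⟩,
    ⟨strictAntiOn_hPlus hb hab, bijOn_hPlus_pos hb hab⟩,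
    (exists_deriv_hMinus_sign_change hb hab).2.1,
    ⟨strictAntiOn_hMinus hb hab, bijOn_hMinus_Icc hb hab⟩,
    ⟨strictMonoOn_hMinus hb hab, bijOn_hMinus_Ici hb hab⟩,
    h₀_mem_Ioo hb hab, fun h k g s => isMultipleRoot_iff hb hab, hneg, hpos, ?_⟩
  ext ⟨h, k, g⟩
  constructor
  · rintro ⟨⟨s, hs⟩, hy⟩
    obtain ⟨hs0, he⟩ := (isMultipleRoot_iff hb hab).1 hs
    have hmem : sheet4Param a b s h ∈ sheet4 a b ∩ bifDiagram a b := he ▸ ⟨⟨s, hs⟩, hy⟩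
    refine ⟨s, h, ?_, he⟩
    rcases hs0.lt_or_gt with h0 | h0
    · exact Or.inl ⟨h0, (hneg s h h0).1 hmem⟩
    · exact Or.inr ⟨h0, (hpos s h h0).1 hmem⟩
  · rintro ⟨s, h', ⟨h0, hr⟩ | ⟨h0, hr⟩, he⟩
    · rw [he]
      exact (hneg s h' h0).2 hr
    · rw [he]
      exact (hpos s h' h0).2 hr
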